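/- **Transformers.** A self-attention head with context length $N$ and embedding dimension $m$ is given by row-wise maps $Q_i,K_i,V_i:\mathbb R^m\to\mathbb R^m$ ($1\le i\le N$), arbitrary and possibly index-specific, and maps $X\in\mathbb R^{N\times m}$ to $f(X)=\mathrm{softmax}(Q(X)K(X)^{\mathsf T})V(X)$, where softmax is applied to each row. A transformer of depth $L$ with $H$ heads per layer consists of heads $f_{\ell,h}$ ($\ell\le L$, $h\le H$) and arbitrary output maps $\psi_i:\mathbb R^m\to\mathbb R$. On input $x\in\mathbb R^N$ it computes $X^0$, with rows $(x_i,0,\dots,0)$, then $X^\ell=X^{\ell-1}+\sum_h f_{\ell,h}(X^{\ell-1})$, and returns $(\psi_i(X^L_i))_{i\le N}$. It has precision $p$ if all entries of $Q,K,V$, on all inputs, are integer multiples of $2^{-p}$ of absolute value at most $2^p$. A valid implementation replaces each head $f_{\ell,h}$ by any map $\hat f_{\ell,h}$ with $\sup_X\|f_{\ell,h}(X)-\hat f_{\ell,h}(X)\|_\infty\le 2^{-p}$ (for instance, exact arithmetic or rounding). **MPC.** For constants $\gamma,\delta>0$, an $R$-round $(\gamma,\delta)$-MPC protocol $\pi$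 on $n$ input words and $n_{\rm out}$ output words has $q=\Theta(n^{1+\gamma-\delta})$ machines with local memory of $s=O(n^\delta)$ words, where $n,n_{\rm out}\le qs$; words are elements of $\mathbb Z_{2^w}$ with $w=\Theta(\log n)$. Machine $i$ is responsible for positions $s(i-1)+1,\dots,si$ of the input and of the output, and initially holds its input words together with their positions. In each round every machine computes an arbitrary function (depending on the machine and the round) of its local memory, which yields a set of addressed messages (non-empty sequences of words); its next memory is the set of all messages addressed to it, each tagged with its sender. On every input and in every round each machine sends at most $s$ words and receives at most $s$ words. Output word $\iota$ is read off, by a fixed function depending only on $\iota$, from the final memory of the machine responsible for $\iota$. In a randomized protocol the local computation of machine $i$ in round $r$ also depends on a random seed $\rho_{r,i}$, the rules being respected for all seeds $\rho$; write $\pi_\rho$ for the resulting deterministic protocol. **Theorem.** All constants below, including those hidden in $O(\cdot)$, $\Theta(\cdot)$ and "sufficiently large", depend only on $\gamma$, $\delta$ and the constants hidden in the bounds on $q$, $s$, $w$; in particular, not on $R$, $n_{\rm out}\le n$ or the protocol. 1. Let $0<\gamma<\delta<1$. For all sufficiently large $n$ and every deterministic $R$-round $(\gamma,\delta)$-MPC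 protocol $\pi$ on $n$ input words and $n_{\rm out}\le n$ output words, there is a transformer $T$ with context length $N=n$, embedding dimension $m=O(n^{4\delta}\log n)$, depth $L=R+1$, $H=O(\log\log n)$ heads per layer and precision $p=\Theta(\log n)$ such that, for every valid implementation of $T$ and every input $x\in\mathbb Z_{2^w}^n$ (whose words are read as integers in $\{0,\dots,2^w-1\}$), all entries of $X^0,\dots,X^L$ are at most $2^p$ in absolute value and $T(x)_i=\pi(x)_i$ exactly for all $i\le n_{\rm out}$. 2. Let $\gamma,\delta>0$ be arbitrary. For all sufficiently large $n$ and every $R$-round $(\gamma,\delta)$-MPC protocol $\pi$ on $n$ input words and $n_{\rm out}\le n$ output words, possibly randomized, there are $m,L,H,p$ as in 1 and transformers $T_\rho$, one for each choice $\rho$ of the seeds, with these parameters and with context length $M=\max(n,q)=\max(n,O(n^{1+\gamma-\delta}))$, such that for every $\rho$, every valid implementation of $T_\rho$ and every input $x$, extended by $M-n$ blank tokens of value $0$, all entries of $X^0,\dots,X^L$ are at most $2^p$ in absolute value and $T_\rho(x)_i=\pi_\rho(x)_i$ exactly for all $i\le n_{\rm out}$. Moreover $T_\rho$ uses the seeds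 locally: the output maps and the first layer do not depend on $\rho$, and for $1\le r\le R$ the embeddings at position $i$ in layer $r+1$ depend on $\rho$ only through $\rho_{r,i}$ (and not at all if $i>q$). -/

import Mathlib

open scoped BigOperators

noncomputable section

/-! ### Transformers -/

/-- The softmax of a vector. -/
def softmax {N : ℕ} (v : Fin N → ℝ) : Fin N → ℝ :=
  fun j => Real.exp (v j) / ∑ k, Real.exp (v k)

/-- A self-attention head with context length `N` and embedding dimension `m`, given by
row-wise (possibly index-specific) query, key and value embeddings. -/
structure AttentionHead (N m : ℕ) where
  query : Fin N → (Fin m → ℝ) → (Fin m → ℝ)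
  key : Fin N → (Fin m → ℝ) → (Fin m → ℝ)
  value : Fin N → (Fin m → ℝ) → (Fin m → ℝ)

namespace AttentionHead

variable {N m : ℕ}

/-- The matrix `Q(X)`. -/
def queryMatrix (f : AttentionHead N m) (X : Matrix (Fin N) (Fin m) ℝ) :
    Matrix (Fin N) (Fin m) ℝ :=
  Matrix.of fun i => f.query i (X i)

/-- The matrix `K(X)`. -/
def keyMatrix (f : AttentionHead N m) (X : Matrix (Fin N) (Fin m) ℝ) :
    Matrix (Fin N) (Fin m) ℝ :=
  Matrix.of fun i => f.key i (X i)

/-- The matrix `V(X)`. -/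
def valueMatrix (f : AttentionHead N m) (X : Matrix (Fin N) (Fin m) ℝ) :
    Matrix (Fin N) (Fin m) ℝ :=
  Matrix.of fun i => f.value i (X i)

/-- Exact attention `softmax(Q(X) K(X)ᵀ) V(X)`, softmax being applied to each row. -/
def eval (f : AttentionHead N m) (X : Matrix (Fin N) (Fin m) ℝ) : Matrix (Fin N) (Fin m) ℝ :=
  (Matrix.of fun i => softmax ((f.queryMatrix X * (f.keyMatrix X).transpose) i)) * f.valueMatrix X

end AttentionHead

/-- A number of the fixed-point format of precision `p`: an integer multiple of `2 ^ (-p)` of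
absolute value at most `2 ^ p`. -/
def IsFixedPoint (p : ℕ) (z : ℝ) : Prop :=
  |z| ≤ 2 ^ p ∧ ∃ k : ℤ, z * 2 ^ p = k

/-- All query, key and value embeddings of the head take values of precision `p`, on all inputs. -/
def AttentionHead.HasPrecision {N m : ℕ} (f : AttentionHead N m) (p : ℕ) : Prop :=
  ∀ (i : Fin N) (x : Fin m → ℝ) (k : Fin m),
    IsFixedPoint p (f.query i x k) ∧ IsFixedPoint p (f.key i x k) ∧ IsFixedPoint p (f.value i x k)

/-- `g` is a valid implementation, at precision `p`, of the head `f`: it agrees with the exact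
attention up to `2 ^ (-p)` in every entry, uniformly over all inputs. -/
def AttentionHead.IsValidImplementation {N m : ℕ} (f : AttentionHead N m) (p : ℕ)
    (g : Matrix (Fin N) (Fin m) ℝ → Matrix (Fin N) (Fin m) ℝ) : Prop :=
  ∀ (X : Matrix (Fin N) (Fin m) ℝ) (i : Fin N) (k : Fin m), |g X i k - f.eval X i k| ≤ 1 / 2 ^ p

/-- A transformer with context length `N`, embedding dimension `m`, depth `L` and `H` heads per
layer, with scalar input and output tokens, and an element-wise output MLP. -/
structure Transformer (N m L H : ℕ) where
  head : Fin L → Fin H → AttentionHead N m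
  mlp : Fin N → (Fin m → ℝ) → ℝ

namespace Transformer

variable {N m L H : ℕ}

def HasPrecision (T : Transformer N m L H) (p : ℕ) : Prop :=
  ∀ ℓ h, (T.head ℓ h).HasPrecision p

/-- `F ℓ h` is a valid implementation of the head `h` of layer `ℓ`, for all `ℓ` and `h`. -/
def IsValidImplementation (T : Transformer N m L H) (p : ℕ)
    (F : Fin L → Fin H → Matrix (Fin N) (Fin m) ℝ → Matrix (Fin N) (Fin m) ℝ) : Prop :=
  ∀ ℓ h, (T.head ℓ h).IsValidImplementation p (F ℓ h)

/-- The initial embedding `X⁰`: scalar tokens, padded by zeros to dimension `m`. -/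
def initialEmbedding (m : ℕ) (x : Fin N → ℝ) : Matrix (Fin N) (Fin m) ℝ :=
  Matrix.of fun i k => if (k : ℕ) = 0 then x i else 0

/-- The intermediate embeddings `X⁰, …, X^L` on input `x`, when the heads are computed by `F`:
`X^(ℓ+1) = X^ℓ + ∑ h, F ℓ h (X^ℓ)`. -/
def embedding (F : Fin L → Fin H → Matrix (Fin N) (Fin m) ℝ → Matrix (Fin N) (Fin m) ℝ)
    (x : Fin N → ℝ) : Fin (L + 1) → Matrix (Fin N) (Fin m) ℝ :=
  Fin.induction (motive := fun _ => Matrix (Fin N) (Fin m) ℝ) (initialEmbedding m x)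
    (fun ℓ X => X + ∑ h, F ℓ h X)

/-- The output of the transformer on input `x`, when its heads are computed by `F`. The choice
`F ℓ h = (T.head ℓ h).eval` is computation in exact real arithmetic. -/
def output (T : Transformer N m L H)
    (F : Fin L → Fin H → Matrix (Fin N) (Fin m) ℝ → Matrix (Fin N) (Fin m) ℝ)
    (x : Fin N → ℝ) : Fin N → ℝ :=
  fun i => T.mlp i (embedding F x (Fin.last L) i)

end Transformer

/-! ### Massively parallel computation -/

/-- Words of `w` bits, as integers mod `2 ^ w`. -/
abbrev Word (w : ℕ) : Type := ZMod (2 ^ w)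

/-- A message is a sequence of words. -/
abbrev Message (w : ℕ) : Type := List (Word w)

/-- The local memory of a machine at the start of a round: a set of messages, each tagged with
the index of its source (the sending machine; before the first round, the input position). -/
abbrev Memory (w : ℕ) : Type := Finset (Message w × ℕ)

/-- The number of words in a set of tagged messages. -/
def wordCount {w : ℕ} {α : Type} (S : Finset (Message w × α)) : ℕ :=
  ∑ x ∈ S, x.1.length

/-- The data of a deterministic `R`-round MPC protocol with `n` input words, `nout` output words,
`q` machines, local memory of `s` words, and word size `w`. In round `r`, machine `i` with memory
`A` emits the addressed messages `compute r i A`. Machines are numbered from `0`, and machine `i`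
is responsible for the positions `ι` with `s * i ≤ ι < s * (i + 1)` of the input and the output;
output word `ι` is read off by `decode ι` from the final memory of the machine responsible
for it. -/
structure MPCProtocol (n nout q s w R : ℕ) where
  compute : Fin R → Fin q → Memory w → Finset (Message w × Fin q)
  decode : Fin nout → Memory w → Word w
  input_fits : n ≤ q * s
  output_fits : nout ≤ q * s

namespace MPCProtocol

variable {n nout q s w R : ℕ}

/-- The local memories before the first round. -/
def initialMemory (s : ℕ) (inp : Fin n → Word w) (i : Fin q) : Memory w :=
  (Finset.univ.filter fun ι : Fin n => (ι : ℕ) / s = i).image fun ι => ([inp ι], (ι : ℕ))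

/-- Simultaneous transmission: machine `i` receives `(msg, src)` for every `(msg, i)` that was
emitted by `src`. -/
def deliver (out : Fin q → Finset (Message w × Fin q)) (i : Fin q) : Memory w :=
  Finset.univ.biUnion fun src : Fin q =>
    ((out src).filter fun x => x.2 = i).image fun x => (x.1, (src : ℕ))

/-- The local memories after `r` rounds, for `r = 0, …, R`. -/
def memory (π : MPCProtocol n nout q s w R) (inp : Fin n → Word w) :
    Fin (R + 1) → Fin q → Memory w :=
  Fin.induction (motive := fun _ => Fin q → Memory w) (initialMemory s inp)
    (fun r A => deliver fun i => π.compute r i (A i))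

/-- The addressed messages that machine `i` emits in round `r`. -/
def outgoing (π : MPCProtocol n nout q s w R) (inp : Fin n → Word w) (r : Fin R) (i : Fin q) :
    Finset (Message w × Fin q) :=
  π.compute r i (π.memory inp r.castSucc i)

/-- The rules that are ensured on every input: messages are non-empty, and in every round each
machine sends at most `s` words and receives at most `s` words. -/
structure Valid (π : MPCProtocol n nout q s w R) : Prop where
  nonempty : ∀ inp r i, ∀ x ∈ π.outgoing inp r i, x.1 ≠ []
  send_le : ∀ inp r i, wordCount (π.outgoing inp r i) ≤ s
  receive_le : ∀ inp (r : Fin R) i, wordCount (π.memory inp r.succ i) ≤ s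

/-- The machine `⌊ι / s⌋` responsible for output position `ι`. -/
def outputMachine (π : MPCProtocol n nout q s w R) (ι : Fin nout) : Fin q :=
  ⟨(ι : ℕ) / s, Nat.div_lt_of_lt_mul
    (lt_of_lt_of_le ι.isLt (π.output_fits.trans (Nat.mul_comm q s).le))⟩

/-- The output `π(inp)` of the protocol. -/
def output (π : MPCProtocol n nout q s w R) (inp : Fin n → Word w) : Fin nout → Word w :=
  fun ι => π.decode ι (π.memory inp (Fin.last R) (π.outputMachine ι))

end MPCProtocol

/-- A randomized MPC protocol: in round `r`, the local computation of machine `i` may also depend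
on a random seed, which is private to that machine and round. -/
structure RandomizedMPCProtocol (n nout q s w R : ℕ) (Ω : Type*) where
  compute : Fin R → Fin q → Ω → Memory w → Finset (Message w × Fin q)
  decode : Fin nout → Memory w → Word w
  input_fits : n ≤ q * s
  output_fits : nout ≤ q * s

/-- The deterministic protocol that results from fixing all seeds. -/
def RandomizedMPCProtocol.fixSeeds {n nout q s w R : ℕ} {Ω : Type*}
    (π : RandomizedMPCProtocol n nout q s w R Ω) (ρ : Fin R → Fin q → Ω) :
    MPCProtocol n nout q s w R where
  compute r i := π.compute r i (ρ r i)
  decode := π.decode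
  input_fits := π.input_fits
  output_fits := π.output_fits

/-- The quantitative requirements on a `(γ, δ)`-MPC protocol, with implied constant `A`:
`q = Θ(n ^ (1 + γ - δ))` machines, `s = O(n ^ δ)` words of local memory, and words of
`w = Θ(log n)` bits. -/
structure MPCScaling (γ δ A : ℝ) (n q s w : ℕ) : Prop where
  machines_ge : A⁻¹ * (n : ℝ) ^ (1 + γ - δ) ≤ q
  machines_le : (q : ℝ) ≤ A * (n : ℝ) ^ (1 + γ - δ)
  memory_le : (s : ℝ) ≤ A * (n : ℝ) ^ δ
  word_ge : A⁻¹ * Real.log n ≤ w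
  word_le : (w : ℝ) ≤ A * Real.log n

/-! ### Simulation -/

/-- The size of the simulating transformers, with implied constant `C`: embedding dimension
`m = O(n ^ (4 δ) log n)`, number of heads `H = O(log log n)`, precision `p = Θ(log n)`. -/
structure TransformerScaling (δ C : ℝ) (n m H p : ℕ) : Prop where
  dim_le : (m : ℝ) ≤ C * ((n : ℝ) ^ (4 * δ) * Real.log n)
  heads_le : (H : ℝ) ≤ C * Real.log (Real.log n)
  precision_ge : C⁻¹ * Real.log n ≤ p
  precision_le : (p : ℝ) ≤ C * Real.log n

/-- The input words as scalar tokens, followed by blank tokens up to context length `M`. -/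
def inputTokens {n w : ℕ} (M : ℕ) (inp : Fin n → Word w) : Fin M → ℝ :=
  fun i => if h : (i : ℕ) < n then ((inp ⟨i, h⟩).val : ℝ) else 0

/-- The transformer `T`, computed with precision `p`, outputs `y inp` in its first `nout`
positions on every input `inp` (extended by blank tokens): the embeddings of the heads have
precision `p`, and whatever valid implementation `F` of the heads is used, all intermediate
embeddings are bounded by `2 ^ p` and the output is correct. -/
def Transformer.Simulates {M m L H n nout w : ℕ} (T : Transformer M m L H) (p : ℕ)
    (y : (Fin n → Word w) → Fin nout → Word w) : Prop :=
  T.HasPrecision p ∧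
    ∀ F, T.IsValidImplementation p F → ∀ inp : Fin n → Word w,
      (∀ ℓ i k, |Transformer.embedding F (inputTokens M inp) ℓ i k| ≤ 2 ^ p) ∧
      ∀ (ι : Fin nout) (i : Fin M), (i : ℕ) = ι →
        T.output F (inputTokens M inp) i = ((y inp ι).val : ℝ)

/-- A family of transformers, indexed by the seeds of a randomized protocol with `R` rounds and
`q` machines, uses randomness locally: the output MLP and the first layer do not depend on the
seeds, and in layer `r + 1` (layers and rounds being numbered from `0`) the query, key and value
embeddings at position `i` depend on no seed but that of machine `i` in round `r`. -/
def UsesSeedsLocally {M m R H q : ℕ} {Ω : Type*}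
    (T : (Fin R → Fin q → Ω) → Transformer M m (R + 1) H) : Prop :=
  ∀ ρ ρ' : Fin R → Fin q → Ω, (T ρ).mlp = (T ρ').mlp ∧
    ∀ (ℓ : Fin (R + 1)) (h : Fin H) (i : Fin M),
      (∀ (r : Fin R) (j : Fin q), ℓ = r.succ → (j : ℕ) = i → ρ r j = ρ' r j) →
        ((T ρ).head ℓ h).query i = ((T ρ').head ℓ h).query i ∧
        ((T ρ).head ℓ h).key i = ((T ρ').head ℓ h).key i ∧
        ((T ρ).head ℓ h).value i = ((T ρ').head ℓ h).value i

end

noncomputable section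

/-! ### Cover-free families -/

/-! One layer performs one round of communication. Since the embeddings are arbitrary functions of a
row, position `j` can decode the memory of machine `j` from its row and compute the outgoing
messages; attention has to deliver them. The first layer distributes the input, whence `R + 1`
layers. The last one brings to position `i` the memory of the machine responsible for output `i`,
and the output map reads off the word.

Routing. Every position has an address, a set of slots, and the addresses form a cover-free family.
The query is the scaled indicator of the address looked for, the key the indicator of the union of
the addresses of all destinations. The score is maximal if the address is among the destinations;
otherwise cover-freeness leaves some slot uncovered, which costs `2 ^ p`. So softmax is, up to `2 ^
(-p)`, the uniform average over the senders (`abs_routingHead_eval_sub_average_le`).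

Decoding. This average superimposes everything that the senders emit, scaled by their unknown number
`κ ≤ N`. Every word, tagged by source, destination and place, is an item with an integer label, and
a second cover-free family assigns slots to items. A slot records the zeroth, first and second
moments of the labels in it. From these one forms the sum of `(label - a) ^ 2`, divided by `κ`: in
an occupied slot it vanishes if all labels equal `a` and is at least `1 / κ` otherwise. Each item
present is alone in some slot, so the set of items is recovered exactly from noisy data
(`mem_decodedItems_iff`).

Stability. A second head attends to its own position and subtracts the old row. Each row is thus a
fresh encoding with error at most `5 / 2 ^ p`, and exact decoding in every layer prevents errors
from accumulating (`abs_simulator_layer_sub_le`, `simulator_simulates`).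

Size. With `S` of order `n ^ δ`, at most `(S + 1) * S` items are superimposed. Reed–Solomon codes
with a bounded number `k` of coefficients, over a prime field of size `P` of order `S ^ 2`, give
both families; the slots are pairs of field elements, so the dimension `3 * P ^ 2` is of order `n ^
(4 * δ)`. -/

/-- No member of the family is covered by `r` others. -/
def CoverFree {ι σ : Type*} (U : ι → Finset σ) (r : ℕ) : Prop :=
  ∀ (z : ι) (I : Finset ι), z ∉ I → I.card ≤ r → ∃ t ∈ U z, ∀ z' ∈ I, t ∉ U z'

/-- By the union bound, `r` other members cover at most `r * k < P` elements of a member. -/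
theorem CoverFree.of_card_inter_le {ι σ : Type*} [DecidableEq σ] {U : ι → Finset σ} {P k r : ℕ}
    (hcard : ∀ z, (U z).card = P) (hinter : ∀ z z', z ≠ z' → (U z ∩ U z').card ≤ k)
    (h : r * k < P) : CoverFree U r := by
  classical
  intro z I hz hI
  by_contra! hcon
  have hsub : U z ⊆ I.biUnion fun z' => U z ∩ U z' := by
    intro t ht
    obtain ⟨z', hz', ht'⟩ := hcon t ht
    exact Finset.mem_biUnion.2 ⟨z', hz', Finset.mem_inter.2 ⟨ht, ht'⟩⟩
  have h1 : (U z).card ≤ I.card * k :=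
    (Finset.card_le_card hsub).trans (Finset.card_biUnion_le_card_mul _ _ _ fun z' hz' =>
      hinter z z' fun hzz => hz (hzz ▸ hz'))
  rw [hcard] at h1
  exact absurd (h1.trans (Nat.mul_le_mul_right k hI)) (not_le.2 h)

/-- The graph of the polynomial with coefficients `c` over the field with `P` elements. -/
def polynomialGraph {P k : ℕ} [NeZero P] (c : Fin k → ZMod P) : Finset (ZMod P × ZMod P) :=
  Finset.univ.image fun x => (x, ∑ l, c l * x ^ (l : ℕ))

theorem card_polynomialGraph {P k : ℕ} [NeZero P] (c : Fin k → ZMod P) :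
    (polynomialGraph c).card = P := by
  rw [polynomialGraph, Finset.card_image_of_injective _ fun x y h => congrArg Prod.fst h,
    Finset.card_univ, ZMod.card]

/-- Common points of two graphs are agreements of two polynomials of degree less than `k`, and
distinct such polynomials agree in fewer than `k` places. -/
theorem card_polynomialGraph_inter_le {P k : ℕ} [Fact P.Prime] {c c' : Fin k → ZMod P}
    (h : c ≠ c') : (polynomialGraph c ∩ polynomialGraph c').card ≤ k := by
  classical
  let f : (Fin k → ZMod P) → Polynomial (ZMod P) := fun c =>
    ∑ l : Fin k, Polynomial.monomial (l : ℕ) (c l)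
  have heval : ∀ c x, (f c).eval x = ∑ l, c l * x ^ (l : ℕ) := fun c x => by
    simp [f, Polynomial.eval_finsetSum, Polynomial.eval_monomial]
  have hcoeff : ∀ c (l : Fin k), (f c).coeff l = c l := fun c l => by
    simp [f, Polynomial.finsetSum_coeff, Polynomial.coeff_monomial, Fin.val_inj]
  have hdeg : ∀ c, (f c).degree < k := fun c => by
    refine (Polynomial.degree_sum_le _ _).trans_lt ((Finset.sup_lt_iff (WithBot.bot_lt_coe k)).2 ?_)
    intro l _
    exact (Polynomial.degree_monomial_le _ _).trans_lt (WithBot.coe_lt_coe.2 l.isLt)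
  by_contra! hlt
  -- A graph has one point over each abscissa, so counting points of intersection is counting
  -- abscissas of agreement.
  have hinj : Set.InjOn Prod.fst
      ((polynomialGraph c ∩ polynomialGraph c' : Finset _) : Set (ZMod P × ZMod P)) := by
    intro a ha b hb hab
    simp only [polynomialGraph, Finset.coe_inter, Finset.coe_image, Finset.coe_univ,
      Set.image_univ, Set.mem_inter_iff, Set.mem_range] at ha hb
    obtain ⟨⟨x, rfl⟩, -⟩ := ha
    obtain ⟨⟨y, rfl⟩, -⟩ := hb
    obtain rfl : x = y := hab
    rfl
  have hk : (k : WithBot ℕ) <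
      (((polynomialGraph c ∩ polynomialGraph c').image Prod.fst).card : WithBot ℕ) := by
    rw [Finset.card_image_of_injOn hinj]
    exact_mod_cast hlt
  have hff : f c = f c' := by
    refine Polynomial.eq_of_degrees_lt_of_eval_finset_eq _ ((hdeg c).trans hk) ((hdeg c').trans hk)
      ?_
    intro x hx
    obtain ⟨y, hy, rfl⟩ := Finset.mem_image.1 hx
    simp only [polynomialGraph, Finset.mem_inter, Finset.mem_image, Finset.mem_univ,
      true_and] at hy
    obtain ⟨⟨a, rfl⟩, b, hb⟩ := hy
    obtain rfl : b = a := congrArg Prod.fst hb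
    rw [heval, heval]
    exact (congrArg Prod.snd hb).symm
  exact h (funext fun l => by rw [← hcoeff c l, ← hcoeff c' l, hff])

/-- Reed–Solomon codes provide cover-free families. -/
theorem exists_coverFree (ι : Type*) [Fintype ι] {P k r : ℕ} [Fact P.Prime]
    (hι : Fintype.card ι ≤ P ^ k) (h : r * k < P) :
    ∃ U : ι → Finset (ZMod P × ZMod P), CoverFree U r := by
  -- Indices become coefficient vectors, of which there are `P ^ k`.
  obtain ⟨e⟩ : Nonempty (ι ↪ (Fin k → ZMod P)) :=
    Function.Embedding.nonempty_of_card_le (by simpa [ZMod.card] using hι)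
  exact ⟨fun z => polynomialGraph (e z), CoverFree.of_card_inter_le
    (fun z => card_polynomialGraph _)
    (fun z z' hz => card_polynomialGraph_inter_le (e.injective.ne hz)) h⟩

/-! ### Routing by attention -/

/-- If the scores are equal on `S` and smaller by `B` elsewhere, then attention is close to the
average over `S`. -/
theorem abs_softmax_sum_sub_average_le {N : ℕ} {v x : Fin N → ℝ} {S : Finset (Fin N)}
    (hS : S.Nonempty) {a B V : ℝ} (hv : ∀ j ∈ S, v j = a) (hv' : ∀ j ∉ S, v j ≤ a - B)
    (hx : ∀ j, |x j| ≤ V) :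
    |∑ j, softmax v j * x j - (∑ j ∈ S, x j) / S.card| ≤ 2 * (N * Real.exp (-B) * V) := by
  classical
  set Z := ∑ k, Real.exp (v k) with hZ
  obtain ⟨j₀, hj₀⟩ := hS
  have hcard : (0 : ℝ) < S.card := by exact_mod_cast Finset.card_pos.2 ⟨j₀, hj₀⟩
  have hV : 0 ≤ V := (abs_nonneg _).trans (hx j₀)
  have hZa : Real.exp a ≤ Z := by
    rw [← hv j₀ hj₀]
    exact Finset.single_le_sum (f := fun k => Real.exp (v k)) (fun _ _ => (Real.exp_pos _).le)
      (Finset.mem_univ j₀)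
  have hZpos : 0 < Z := (Real.exp_pos a).trans_le hZa
  have hw : ∀ j, softmax v j = Real.exp (v j) / Z := fun _ => rfl
  have hwS : ∀ j ∈ S, softmax v j = Real.exp a / Z := fun j hj => by rw [hw, hv j hj]
  have hwpos : ∀ j, 0 ≤ softmax v j := fun j => by rw [hw]; positivity
  have hwsum : ∑ j, softmax v j = 1 := by
    simp only [hw, ← Finset.sum_div]
    exact div_self hZpos.ne'
  have hwS' : ∀ j ∉ S, softmax v j ≤ Real.exp (-B) := fun j hj => by
    rw [hw, div_le_iff₀ hZpos]
    calc Real.exp (v j) ≤ Real.exp (-B + a) := Real.exp_le_exp.2 (by linarith [hv' j hj])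
      _ = Real.exp (-B) * Real.exp a := Real.exp_add _ _
      _ ≤ _ := mul_le_mul_of_nonneg_left hZa (Real.exp_pos _).le
  set η := ∑ j ∈ Sᶜ, softmax v j with hη
  have hη0 : 0 ≤ η := Finset.sum_nonneg fun j _ => hwpos j
  have hη1 : η ≤ N * Real.exp (-B) := by
    calc η ≤ ∑ j ∈ Sᶜ, Real.exp (-B) :=
          Finset.sum_le_sum fun j hj => hwS' j (Finset.mem_compl.1 hj)
      _ = (Sᶜ.card : ℝ) * Real.exp (-B) := by simp
      _ ≤ _ := by
          gcongr
          simpa using Finset.card_le_univ Sᶜ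
  have hsplit : (S.card : ℝ) * (Real.exp a / Z) + η = 1 := by
    rw [← hwsum, ← Finset.sum_add_sum_compl S, Finset.sum_congr rfl hwS]
    simp [hη]
  have h1 : |∑ j ∈ Sᶜ, softmax v j * x j| ≤ η * V := by
    rw [hη, Finset.sum_mul]
    refine (Finset.abs_sum_le_sum_abs _ _).trans (Finset.sum_le_sum fun j _ => ?_)
    rw [abs_mul, abs_of_nonneg (hwpos j)]
    exact mul_le_mul_of_nonneg_left (hx j) (hwpos j)
  have h2 : |∑ j ∈ S, x j| ≤ S.card * V := by
    refine (Finset.abs_sum_le_sum_abs _ _).trans ((Finset.sum_le_sum fun j _ => hx j).trans ?_)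
    simp
  -- Each weight inside `S` is `(1 - η) / S.card`. The mass `η` missing inside `S` and the mass `η`
  -- present outside each cost at most `η * V`, whence the factor 2.
  have h3 : ∑ j ∈ S, softmax v j * x j - (∑ j ∈ S, x j) / S.card
      = -(η / S.card * ∑ j ∈ S, x j) := by
    rw [Finset.sum_congr rfl fun j hj => by rw [hwS j hj], ← Finset.mul_sum]
    have : Real.exp a / Z = (1 - η) / S.card := by
      rw [eq_div_iff hcard.ne']
      linarith
    rw [this]
    ring
  have h4 : |η / S.card * ∑ j ∈ S, x j| ≤ η * V := by
    rw [abs_mul, abs_of_nonneg (by positivity : 0 ≤ η / S.card)]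
    calc η / S.card * |∑ j ∈ S, x j| ≤ η / S.card * (S.card * V) := by gcongr
      _ = η * V := by field_simp
  have h5 : ∑ j, softmax v j * x j - (∑ j ∈ S, x j) / S.card
      = ∑ j ∈ Sᶜ, softmax v j * x j + -(η / S.card * ∑ j ∈ S, x j) := by
    rw [← h3, ← Finset.sum_add_sum_compl S]
    ring
  rw [h5]
  refine (abs_add_le _ _).trans ?_
  rw [abs_neg]
  have := mul_le_mul_of_nonneg_right hη1 hV
  linarith

theorem sum_extend_mul_extend {α β : Type*} [Fintype α] [Fintype β] (e : α ↪ β) (f g : α → ℝ) :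
    ∑ t, Function.extend e f (0 : β → ℝ) t * Function.extend e g (0 : β → ℝ) t = ∑ a, f a * g a := by
  classical
  have h : ∀ t ∉ Finset.univ.map e,
      Function.extend e f (0 : β → ℝ) t * Function.extend e g (0 : β → ℝ) t = 0 := by
    intro t ht
    rw [Function.extend_apply' _ _ _ fun ⟨a, ha⟩ => ht (by simp [← ha])]
    simp
  rw [← Finset.sum_subset (Finset.subset_univ (Finset.univ.map e)) fun t _ ht => h t ht,
    Finset.sum_map]
  simp [e.injective.extend_apply]

section RoutingHead

variable {N m : ℕ} {Slot : Type} [DecidableEq Slot]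

/-- The head in which position `i` attends uniformly to the positions `j` whose destinations
`dst j` include the address of `i`. -/
def routingHead (p : ℕ) (e : Slot ↪ Fin m) (U : Fin N → Finset Slot) (addr : Fin N → Fin N)
    (dst : Fin N → (Fin m → ℝ) → Finset (Fin N)) (val : Fin N → (Fin m → ℝ) → (Fin m → ℝ)) :
    AttentionHead N m where
  query i _ := Function.extend e (fun t => if t ∈ U (addr i) then 2 ^ p else 0) 0
  key j x := Function.extend e (fun t => if t ∈ (dst j x).biUnion U then 1 else 0) 0
  value := val

variable {p : ℕ} {e : Slot ↪ Fin m} {U : Fin N → Finset Slot} {addr : Fin N → Fin N}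
  {dst : Fin N → (Fin m → ℝ) → Finset (Fin N)} {val : Fin N → (Fin m → ℝ) → (Fin m → ℝ)}

theorem isFixedPoint_natCast {p n : ℕ} (h : n ≤ 2 ^ p) : IsFixedPoint p (n : ℝ) :=
  ⟨by rw [abs_of_nonneg (Nat.cast_nonneg n)]; exact_mod_cast h, n * 2 ^ p, by push_cast; rfl⟩

theorem IsFixedPoint.neg {p : ℕ} {z : ℝ} (h : IsFixedPoint p z) : IsFixedPoint p (-z) := by
  obtain ⟨h1, k, hk⟩ := h
  exact ⟨by rwa [abs_neg], -k, by push_cast; rw [← hk]; ring⟩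

theorem IsFixedPoint.extend {α β : Type*} {p : ℕ} {e : α ↪ β} {f : α → ℝ}
    (h : ∀ a, IsFixedPoint p (f a)) (t : β) : IsFixedPoint p (Function.extend e f 0 t) := by
  by_cases ht : ∃ a, e a = t
  · obtain ⟨a, rfl⟩ := ht
    rw [e.injective.extend_apply]
    exact h a
  · rw [Function.extend_apply' _ _ _ ht]
    simpa using isFixedPoint_natCast (p := p) (Nat.zero_le _)

theorem routingHead_hasPrecision (hval : ∀ j x k, IsFixedPoint p (val j x k)) :
    (routingHead p e U addr dst val).HasPrecision p := by
  intro i x k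
  simp only [routingHead]
  refine ⟨IsFixedPoint.extend (fun t => ?_) k, IsFixedPoint.extend (fun t => ?_) k, hval i x k⟩
  · split_ifs
    · simpa using isFixedPoint_natCast (p := p) le_rfl
    · simpa using isFixedPoint_natCast (p := p) (Nat.zero_le _)
  · split_ifs
    · simpa using isFixedPoint_natCast (p := p) Nat.one_le_two_pow
    · simpa using isFixedPoint_natCast (p := p) (Nat.zero_le _)

variable [Fintype Slot]

/-- The score counts the slots of the address that are covered by the destinations. -/
theorem routingHead_score (X : Matrix (Fin N) (Fin m) ℝ) (i j : Fin N) :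
    ((routingHead p e U addr dst val).queryMatrix X *
      ((routingHead p e U addr dst val).keyMatrix X).transpose) i j =
      2 ^ p * ((U (addr i) ∩ (dst j (X j)).biUnion U).card : ℝ) := by
  rw [Matrix.mul_apply]
  simp only [AttentionHead.queryMatrix, AttentionHead.keyMatrix, Matrix.of_apply,
    Matrix.transpose_apply, routingHead]
  rw [sum_extend_mul_extend]
  simp only [mul_ite, mul_one, mul_zero]
  rw [← Finset.sum_filter, ← Finset.sum_filter, Finset.sum_const, nsmul_eq_mul, mul_comm]
  congr 3
  ext t
  simp [and_comm]

/-- A routing head computes averages over senders, to within one unit of precision. -/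
theorem abs_routingHead_eval_sub_average_le {r : ℕ} (hp : 4 ≤ p) (hN : N ≤ 2 ^ p)
    (hU : CoverFree U r) {X : Matrix (Fin N) (Fin m) ℝ} (hdst : ∀ j, (dst j (X j)).card ≤ r)
    (hval : ∀ j k, |val j (X j) k| ≤ 2 ^ p) (i : Fin N) {S : Finset (Fin N)}
    (hS : ∀ j, j ∈ S ↔ addr i ∈ dst j (X j)) (hne : S.Nonempty) (k : Fin m) :
    |(routingHead p e U addr dst val).eval X i k - (∑ j ∈ S, val j (X j) k) / S.card|
      ≤ 1 / 2 ^ p := by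
  have hmain := abs_softmax_sum_sub_average_le (N := N)
    (v := ((routingHead p e U addr dst val).queryMatrix X *
      ((routingHead p e U addr dst val).keyMatrix X).transpose) i)
    (x := fun j => val j (X j) k) (a := 2 ^ p * ((U (addr i)).card : ℝ)) (B := 2 ^ p)
    (V := 2 ^ p) hne ?_ ?_ (fun j => hval j k)
  · refine le_trans (le_of_eq ?_) (hmain.trans ?_)
    · rw [AttentionHead.eval, Matrix.mul_apply]
      rfl
    · have h2p : (0 : ℝ) < 2 ^ p := by positivity
      have hN' : (N : ℝ) ≤ 2 ^ p := by exact_mod_cast hN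
      have h4p : 4 * p ≤ 2 ^ p := by
        clear hmain hval hN hN' h2p
        induction p, hp using Nat.le_induction with
        | base => norm_num
        | succ p hp ih => rw [pow_succ]; omega
      -- The error is `2 * N * 2 ^ p * exp (-2 ^ p)`. Its first three factors are at most `2 ^ p`
      -- each, so a fourth power in the denominator leaves `1 / 2 ^ p`.
      have hexp : ((2 : ℝ) ^ p) ^ 4 ≤ Real.exp (2 ^ p) := by
        rw [← pow_mul, mul_comm]
        calc (2 : ℝ) ^ (4 * p) ≤ Real.exp 1 ^ (4 * p) := by
              gcongr
              have := Real.add_one_le_exp (1 : ℝ)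
              linarith
          _ = Real.exp ((4 * p : ℕ) : ℝ) := by rw [← Real.exp_nat_mul, mul_one]
          _ ≤ _ := Real.exp_le_exp.2 (by exact_mod_cast h4p)
      have h2 : (2 : ℝ) ≤ 2 ^ p := by
        calc (2 : ℝ) = 2 ^ 1 := by norm_num
          _ ≤ 2 ^ p := pow_le_pow_right₀ (by norm_num) (by omega)
      rw [Real.exp_neg]
      calc 2 * ((N : ℝ) * (Real.exp (2 ^ p))⁻¹ * 2 ^ p)
          ≤ 2 ^ p * (2 ^ p * (((2 : ℝ) ^ p) ^ 4)⁻¹ * 2 ^ p) := by gcongr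
        _ = 1 / 2 ^ p := by field_simp
  · intro j hj
    rw [routingHead_score, Finset.inter_eq_left.2]
    exact Finset.subset_biUnion_of_mem U ((hS j).1 hj)
  · intro j hj
    rw [routingHead_score]
    -- At least one slot of the address stays uncovered, and each slot is worth `2 ^ p`.
    obtain ⟨t, ht, ht'⟩ := hU (addr i) (dst j (X j)) (fun h => hj ((hS j).2 h)) (hdst j)
    have hlt : (U (addr i) ∩ (dst j (X j)).biUnion U).card < (U (addr i)).card := by
      refine Finset.card_lt_card ⟨Finset.inter_subset_left, fun h => ?_⟩
      obtain ⟨d, hd, htd⟩ := Finset.mem_biUnion.1 (Finset.mem_inter.1 (h ht)).2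
      exact ht' d hd htd
    have hlt' : ((U (addr i) ∩ (dst j (X j)).biUnion U).card : ℝ) + 1 ≤ (U (addr i)).card := by
      exact_mod_cast hlt
    have h2p : (0 : ℝ) < 2 ^ p := by positivity
    nlinarith

end RoutingHead

section Items
/-! ### Encoding messages as sets of items -/

/-- Non-empty messages cost at least one word each; this turns bounds on words into bounds on the
numbers of messages, destinations and senders. -/
theorem card_le_wordCount {w : ℕ} {α : Type} {S : Finset (Message w × α)}
    (h : ∀ x ∈ S, x.1 ≠ []) : S.card ≤ wordCount S := by
  rw [wordCount, Finset.card_eq_sum_ones]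
  exact Finset.sum_le_sum fun x hx => List.length_pos_iff.2 (h x hx)

theorem length_le_wordCount {w : ℕ} {α : Type} {S : Finset (Message w × α)} {x : Message w × α}
    (h : x ∈ S) : x.1.length ≤ wordCount S :=
  Finset.single_le_sum (f := fun x : Message w × α => x.1.length) (fun _ _ => Nat.zero_le _) h

/-- An item consists of a source, a destination, the index of a message at the source, a position
in this message, and the word at this position. -/
abbrev Item (N S w : ℕ) : Type := Fin N × Fin N × Fin S × Fin S × Word w

variable {N S w m : ℕ}

/-- Items as natural numbers. -/
def itemLabel (z : Item N S w) : ℕ := Fintype.equivFin (Item N S w) z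

theorem itemLabel_lt (z : Item N S w) : itemLabel z < Fintype.card (Item N S w) :=
  (Fintype.equivFin (Item N S w) z).isLt

theorem itemLabel_injective : Function.Injective (itemLabel : Item N S w → ℕ) :=
  Fin.val_injective.comp (Fintype.equivFin (Item N S w)).injective

open Classical in
/-- The items that make up the addressed messages `out` of source `j`. -/
def itemsOf (S : ℕ) (j : Fin N) (out : Finset (Message w × Fin N)) : Finset (Item N S w) :=
  -- The index refers to the arbitrary but fixed order of `out.toList`; it keeps apart several
  -- messages from one source to one destination.
  Finset.univ.filter fun z => z.1 = j ∧ ∃ msg, out.toList[(z.2.2.1 : ℕ)]? = some (msg, z.2.1) ∧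
    msg[(z.2.2.2.1 : ℕ)]? = some z.2.2.2.2

theorem mem_itemsOf {j j' a : Fin N} {τ pos : Fin S} {v : Word w}
    {out : Finset (Message w × Fin N)} :
    (j', a, τ, pos, v) ∈ itemsOf S j out ↔ j' = j ∧ ∃ msg, out.toList[(τ : ℕ)]? = some (msg, a) ∧
      msg[(pos : ℕ)]? = some v := by
  simp [itemsOf]

/-- Within one message the position determines the item: it fixes the word, and the list has no
repetitions, so the message fixes its index. Hence a message has no more items than words. -/
theorem card_itemsOf_le (j : Fin N) (out : Finset (Message w × Fin N)) :
    (itemsOf S j out).card ≤ wordCount out := by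
  classical
  let f : Message w × Fin N → Finset (Item N S w) := fun x =>
    (itemsOf S j out).filter fun z => out.toList[(z.2.2.1 : ℕ)]? = some x
  have hsub : itemsOf S j out ⊆ out.biUnion f := by
    rintro ⟨j', a, τ, pos, v⟩ hz
    obtain ⟨-, msg, hmsg, -⟩ := mem_itemsOf.1 hz
    exact Finset.mem_biUnion.2 ⟨(msg, a), Finset.mem_toList.1 (List.mem_of_getElem? hmsg),
      Finset.mem_filter.2 ⟨hz, hmsg⟩⟩
  refine (Finset.card_le_card hsub).trans (Finset.card_biUnion_le.trans ?_)
  refine Finset.sum_le_sum fun x _ => ?_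
  rw [← Finset.card_range x.1.length]
  refine Finset.card_le_card_of_injOn (fun z => (z.2.2.2.1 : ℕ)) ?_ ?_
  · rintro ⟨j', a, τ, pos, v⟩ hz
    obtain ⟨hz, hx⟩ := Finset.mem_filter.1 hz
    obtain ⟨-, msg, hmsg, hv⟩ := mem_itemsOf.1 hz
    obtain rfl : (msg, a) = x := Option.some.inj (hmsg.symm.trans hx)
    simpa using (List.getElem?_eq_some_iff.1 hv).1
  · rintro ⟨j₁, a₁, τ₁, pos₁, v₁⟩ h₁ ⟨j₂, a₂, τ₂, pos₂, v₂⟩ h₂ hpos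
    obtain ⟨hz₁, hx₁⟩ := Finset.mem_filter.1 h₁
    obtain ⟨hz₂, hx₂⟩ := Finset.mem_filter.1 h₂
    obtain ⟨rfl, msg₁, hmsg₁, hv₁⟩ := mem_itemsOf.1 hz₁
    obtain ⟨rfl, msg₂, hmsg₂, hv₂⟩ := mem_itemsOf.1 hz₂
    obtain rfl : (msg₁, a₁) = x := Option.some.inj (hmsg₁.symm.trans hx₁)
    obtain ⟨rfl, rfl⟩ := Prod.mk.inj (Option.some.inj (hmsg₂.symm.trans hx₂))
    obtain rfl : pos₁ = pos₂ := Fin.ext hpos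
    obtain rfl : v₁ = v₂ := Option.some.inj (hv₁.symm.trans hv₂)
    obtain ⟨hlt, hget₁⟩ := List.getElem?_eq_some_iff.1 hx₁
    obtain ⟨hlt', hget₂⟩ := List.getElem?_eq_some_iff.1 hx₂
    obtain rfl : τ₁ = τ₂ := Fin.ext <|
      (List.Nodup.getElem_inj_iff out.nodup_toList).1 (hget₁.trans hget₂.symm)
    rfl

/-- The rules for the addressed messages of one round. -/
structure Admissible (S : ℕ) (out : Fin N → Finset (Message w × Fin N)) : Prop where
  nonempty : ∀ j, ∀ x ∈ out j, x.1 ≠ []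
  send_le : ∀ j, wordCount (out j) ≤ S
  receive_le : ∀ a, wordCount (MPCProtocol.deliver out a) ≤ S

theorem mem_deliver {out : Fin N → Finset (Message w × Fin N)} {a : Fin N} {msg : Message w}
    {src : ℕ} :
    (msg, src) ∈ MPCProtocol.deliver out a ↔ ∃ j : Fin N, (msg, a) ∈ out j ∧ (j : ℕ) = src := by
  simp [MPCProtocol.deliver]

/-- The destinations of a position that emits `out`, to which it adds itself. -/
def destinations (j : Fin N) (out : Finset (Message w × Fin N)) : Finset (Fin N) :=
  insert j (out.image Prod.snd)

/-- The positions whose destinations include `a`. -/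
def senders (out : Fin N → Finset (Message w × Fin N)) (a : Fin N) : Finset (Fin N) :=
  Finset.univ.filter fun j => a ∈ destinations j (out j)

theorem mem_senders {out : Fin N → Finset (Message w × Fin N)} {a j : Fin N} :
    j ∈ senders out a ↔ a ∈ destinations j (out j) := by
  simp [senders]

/-- This is what adding a position to its own destinations achieves: there is always somebody to
average over. The superfluous items carry other destinations and are ignored in decoding. -/
theorem senders_nonempty (out : Fin N → Finset (Message w × Fin N)) (a : Fin N) :
    (senders out a).Nonempty :=
  ⟨a, mem_senders.2 (Finset.mem_insert_self _ _)⟩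

theorem Admissible.card_destinations_le {out : Fin N → Finset (Message w × Fin N)}
    (h : Admissible S out) (j : Fin N) : (destinations j (out j)).card ≤ S + 1 :=
  (Finset.card_insert_le _ _).trans <| Nat.succ_le_succ <|
    Finset.card_image_le.trans ((card_le_wordCount (h.nonempty j)).trans (h.send_le j))

/-- Each sender other than `a` itself delivers at least one of the at most `S` words received. -/
theorem Admissible.card_senders_le {out : Fin N → Finset (Message w × Fin N)}
    (h : Admissible S out) (a : Fin N) : (senders out a).card ≤ S + 1 := by
  have hsub : (senders out a).map Fin.valEmbedding ⊆
      insert (a : ℕ) ((MPCProtocol.deliver out a).image Prod.snd) := by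
    intro x hx
    obtain ⟨j, hj, rfl⟩ := Finset.mem_map.1 hx
    rcases Finset.mem_insert.1 (mem_senders.1 hj) with rfl | hj
    · exact Finset.mem_insert_self _ _
    · obtain ⟨⟨msg, d⟩, hmsg, rfl⟩ := Finset.mem_image.1 hj
      exact Finset.mem_insert_of_mem
        (Finset.mem_image.2 ⟨(msg, j), mem_deliver.2 ⟨j, hmsg, rfl⟩, rfl⟩)
  rw [← Finset.card_map Fin.valEmbedding]
  refine (Finset.card_le_card hsub).trans <| (Finset.card_insert_le _ _).trans <|
    Nat.succ_le_succ <| Finset.card_image_le.trans <|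
      (card_le_wordCount ?_).trans (h.receive_le a)
  rintro ⟨msg, src⟩ hx
  obtain ⟨j, hj, -⟩ := mem_deliver.1 hx
  exact h.nonempty j _ hj

/-- All items of the positions whose destinations include `a`. -/
def incomingItems (S : ℕ) (out : Fin N → Finset (Message w × Fin N)) (a : Fin N) :
    Finset (Item N S w) :=
  (senders out a).biUnion fun j => itemsOf S j (out j)

/-- The value of a head does not depend on the receiver, so a sender contributes all of its items,
including those meant for others. This is the reason for a quadratic bound in place of a linear one.
-/
theorem Admissible.card_incomingItems_le {out : Fin N → Finset (Message w × Fin N)}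
    (h : Admissible S out) (a : Fin N) : (incomingItems S out a).card ≤ (S + 1) * S :=
  (Finset.card_biUnion_le_card_mul _ _ _ fun j _ =>
    (card_itemsOf_le j (out j)).trans (h.send_le j)).trans
      (Nat.mul_le_mul_right S (h.card_senders_le a))

/-- Prescribing the destination `a` inside the item removes all traffic meant for others. -/
theorem mem_incomingItems {out : Fin N → Finset (Message w × Fin N)} {j a : Fin N}
    {τ pos : Fin S} {v : Word w} :
    (j, a, τ, pos, v) ∈ incomingItems S out a ↔
      ∃ msg, (out j).toList[(τ : ℕ)]? = some (msg, a) ∧ msg[(pos : ℕ)]? = some v := by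
  rw [incomingItems, Finset.mem_biUnion]
  constructor
  · rintro ⟨j', -, hz⟩
    obtain ⟨rfl, h⟩ := mem_itemsOf.1 hz
    exact h
  · rintro ⟨msg, hmsg, hv⟩
    refine ⟨j, mem_senders.2 (Finset.mem_insert_of_mem ?_), mem_itemsOf.2 ⟨rfl, msg, hmsg, hv⟩⟩
    exact Finset.mem_image.2 ⟨_, Finset.mem_toList.1 (List.mem_of_getElem? hmsg), rfl⟩

/-! ### Superimposed codes for sets of items -/

variable {Slot : Type} [DecidableEq Slot]

/-- The encoding of a set of items: in each slot, the sums of the powers `0`, `1`, `2` of the labels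
of the items to which this slot is assigned. -/
def payload (e : Slot × Fin 3 ↪ Fin m) (U : Item N S w → Finset Slot)
    (I : Finset (Item N S w)) : Fin m → ℝ :=
  Function.extend e (fun t => ∑ z ∈ I with t.1 ∈ U z, (itemLabel z : ℝ) ^ (t.2 : ℕ)) 0

theorem payload_apply (e : Slot × Fin 3 ↪ Fin m) (U : Item N S w → Finset Slot)
    (I : Finset (Item N S w)) (t : Slot) (c : Fin 3) :
    payload e U I (e (t, c)) = ∑ z ∈ I with t ∈ U z, (itemLabel z : ℝ) ^ (c : ℕ) :=
  e.injective.extend_apply _ _ _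

/-- Entries are bounded natural numbers, hence representable without rounding once `2 ^ p` exceeds
the bound. -/
theorem exists_payload_eq_natCast (e : Slot × Fin 3 ↪ Fin m) (U : Item N S w → Finset Slot)
    (I : Finset (Item N S w)) (k : Fin m) :
    ∃ n : ℕ, n ≤ Fintype.card (Item N S w) ^ 3 ∧ payload e U I k = n := by
  by_cases hk : ∃ t, e t = k
  · obtain ⟨⟨t, c⟩, rfl⟩ := hk
    refine ⟨∑ z ∈ I with t ∈ U z, itemLabel z ^ (c : ℕ), ?_, by rw [payload_apply]; push_cast; rfl⟩
    calc ∑ z ∈ I with t ∈ U z, itemLabel z ^ (c : ℕ)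
        ≤ ∑ z ∈ I with t ∈ U z, Fintype.card (Item N S w) ^ 2 := by
          refine Finset.sum_le_sum fun z _ => ?_
          have hz := itemLabel_lt z
          exact (Nat.pow_le_pow_left hz.le _).trans
            (Nat.pow_le_pow_right (by omega) (by omega))
      _ ≤ Fintype.card (Item N S w) * Fintype.card (Item N S w) ^ 2 := by
          rw [Finset.sum_const, smul_eq_mul]
          exact Nat.mul_le_mul_right _ (Finset.card_le_univ _)
      _ = _ := by ring
  · exact ⟨0, Nat.zero_le _, by rw [payload, Function.extend_apply' _ _ _ hk]; simp⟩

/-- Encodings add up over disjoint unions, and items of different positions differ in their source.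
-/
theorem sum_payload_itemsOf (e : Slot × Fin 3 ↪ Fin m) (U : Item N S w → Finset Slot)
    (out : Fin N → Finset (Message w × Fin N)) (a : Fin N) (k : Fin m) :
    ∑ j ∈ senders out a, payload e U (itemsOf S j (out j)) k =
      payload e U (incomingItems S out a) k := by
  classical
  by_cases hk : ∃ t, e t = k
  · obtain ⟨⟨t, c⟩, rfl⟩ := hk
    simp only [payload_apply]
    rw [incomingItems, Finset.filter_biUnion, Finset.sum_biUnion]
    intro j _ j' _ hjj
    refine Finset.disjoint_left.2 ?_
    rintro ⟨i, b, τ, pos, v⟩ hz hz'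
    exact hjj ((mem_itemsOf.1 (Finset.mem_filter.1 hz).1).1.symm.trans
      (mem_itemsOf.1 (Finset.mem_filter.1 hz').1).1)
  · simp only [payload, Function.extend_apply' _ _ _ hk]
    simp

/-- The items that are recognized in the (perturbed and scaled) encoding `y` of a set of items. -/
def decodedItems (e : Slot × Fin 3 ↪ Fin m) (y : Fin m → ℝ) : Set (Item N S w) :=
  -- Slot `t` must be occupied, and the second moment about the label of `z` must vanish there.
  -- Before perturbation both quantities are `0` or at least `1 / N`, and the threshold lies
  -- halfway.
  {z | ∃ t : Slot, 1 / (2 * N : ℝ) < y (e (t, 0)) ∧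
    y (e (t, 2)) - 2 * itemLabel z * y (e (t, 1)) + (itemLabel z : ℝ) ^ 2 * y (e (t, 0))
      < 1 / (2 * N : ℝ)}

/-- A sum of squares of integers is `0` or at least `1`. After division by `κ ≤ N` the gap is still
`1 / N`, while the perturbation moves each test quantity by at most `1 / (4 * N)`. -/
theorem mem_decodedItems_iff {e : Slot × Fin 3 ↪ Fin m} {U : Item N S w → Finset Slot} {r κ p : ℕ}
    (hU : CoverFree U r) {I : Finset (Item N S w)} (hI : I.card ≤ r) (hκ : 0 < κ) (hκN : κ ≤ N)
    (hp : 32 * N * (Fintype.card (Item N S w) + 1) ^ 2 ≤ 2 ^ p) {y : Fin m → ℝ}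
    (hy : ∀ k, |y k - payload e U I k / κ| ≤ 5 / 2 ^ p) (z : Item N S w) :
    z ∈ decodedItems e y ↔ z ∈ I := by
  classical
  set ε : ℝ := 5 / 2 ^ p with hε
  set a : ℝ := (itemLabel z : ℝ) with ha
  have ha0 : 0 ≤ a := Nat.cast_nonneg _
  have hκ' : (0 : ℝ) < κ := by exact_mod_cast hκ
  have hN' : (0 : ℝ) < N := hκ'.trans_le (by exact_mod_cast hκN)
  have hκN' : 1 / (N : ℝ) ≤ 1 / κ := by
    apply one_div_le_one_div_of_le hκ'
    exact_mod_cast hκN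
  have hε0 : 0 ≤ ε := by positivity
  -- The three moments enter with coefficients `1`, `2 * a`, `a ^ 2`, so the error is amplified by
  -- `(a + 1) ^ 2`.
  have hεa : ε * (a + 1) ^ 2 ≤ 1 / (4 * N) := by
    have h1 : (32 : ℝ) * N * (a + 1) ^ 2 ≤ 2 ^ p := by
      have h2 : 32 * N * (itemLabel z + 1) ^ 2 ≤ 2 ^ p := by
        refine le_trans ?_ hp
        gcongr
        exact (itemLabel_lt z).le
      rw [ha]
      exact_mod_cast h2
    rw [hε, div_mul_eq_mul_div, div_le_div_iff₀ (by positivity) (by positivity)]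
    nlinarith [mul_nonneg hN'.le (sq_nonneg (a + 1))]
  have hε1 : ε ≤ 1 / (4 * N) :=
    (le_mul_of_one_le_right hε0 (by nlinarith)).trans hεa
  have hsplit : 1 / (4 * N : ℝ) = 1 / N / 4 := by field_simp
  have hsplit' : 1 / (2 * N : ℝ) = 1 / N / 2 := by field_simp
  have hNinv : 0 < 1 / (N : ℝ) := by positivity
  have hquad : ∀ t : Slot,
      |(y (e (t, 2)) - 2 * a * y (e (t, 1)) + a ^ 2 * y (e (t, 0))) -
        (∑ z' ∈ I with t ∈ U z', ((itemLabel z' : ℝ) - a) ^ 2) / κ| ≤ 1 / (4 * N : ℝ) := by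
    intro t
    have hsum : ∑ z' ∈ I with t ∈ U z', ((itemLabel z' : ℝ) - a) ^ 2 =
        payload e U I (e (t, 2)) - 2 * a * payload e U I (e (t, 1)) +
          a ^ 2 * payload e U I (e (t, 0)) := by
      simp only [payload_apply, Finset.mul_sum, ← Finset.sum_sub_distrib, ← Finset.sum_add_distrib]
      refine Finset.sum_congr rfl fun z' _ => ?_
      simp
      ring
    have h0 := abs_le.1 (hy (e (t, 0)))
    have h1 := abs_le.1 (hy (e (t, 1)))
    have h2 := abs_le.1 (hy (e (t, 2)))
    rw [hsum]
    refine le_trans (abs_le.2 ⟨?_, ?_⟩) hεa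
    · rw [add_div, sub_div, mul_div_assoc, mul_div_assoc]
      nlinarith [mul_le_mul_of_nonneg_left h0.1 (sq_nonneg a), mul_le_mul_of_nonneg_left h1.2 ha0]
    · rw [add_div, sub_div, mul_div_assoc, mul_div_assoc]
      nlinarith [mul_le_mul_of_nonneg_left h0.2 (sq_nonneg a), mul_le_mul_of_nonneg_left h1.1 ha0]
  constructor
  -- No false positives: some item of `I` occupies the slot, and its label is at distance less than
  -- `1` from that of `z`. Cover-freeness is not needed here.
  · rintro ⟨t, ht0, ht⟩
    have hne : (I.filter fun z' => t ∈ U z').Nonempty := by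
      by_contra hemp
      have h0 := (abs_le.1 (hy (e (t, 0)))).2
      rw [payload_apply, Finset.not_nonempty_iff_eq_empty.1 hemp, Finset.sum_empty] at h0
      simp only [zero_div, sub_zero] at h0
      linarith
    obtain ⟨z', hz'⟩ := hne
    have hlt : (∑ z' ∈ I with t ∈ U z', ((itemLabel z' : ℝ) - a) ^ 2) / κ < 1 / κ := by
      have := (abs_le.1 (hquad t)).1
      linarith
    have hlt1 : ∑ z' ∈ I with t ∈ U z', ((itemLabel z' : ℝ) - a) ^ 2 < 1 :=
      (div_lt_div_iff_of_pos_right hκ').1 hlt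
    have hz1 : ((itemLabel z' : ℝ) - a) ^ 2 < 1 :=
      (Finset.single_le_sum (f := fun z' : Item N S w => ((itemLabel z' : ℝ) - a) ^ 2)
        (fun _ _ => sq_nonneg _) hz').trans_lt hlt1
    have hz2 := abs_lt.1 ((sq_lt_one_iff_abs_lt_one _).1 hz1)
    have hlt₁ : (itemLabel z' : ℝ) < itemLabel z + 1 := by linarith [hz2.2]
    have hlt₂ : (itemLabel z : ℝ) < itemLabel z' + 1 := by linarith [hz2.1]
    have hz3 : itemLabel z' = itemLabel z :=
      le_antisymm (Nat.lt_succ_iff.1 (by exact_mod_cast hlt₁))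
        (Nat.lt_succ_iff.1 (by exact_mod_cast hlt₂))
    rw [← itemLabel_injective hz3]
    exact (Finset.mem_filter.1 hz').1
  · intro hz
    -- No omissions: cover-freeness provides a slot in which `z` is alone.
    obtain ⟨t, ht, ht'⟩ := hU z (I.erase z) (Finset.notMem_erase _ _)
      ((Finset.card_erase_le).trans hI)
    have hfilter : (I.filter fun z' => t ∈ U z') = {z} := by
      ext z'
      simp only [Finset.mem_filter, Finset.mem_singleton]
      constructor
      · rintro ⟨hz', htz⟩
        by_contra hzz
        exact ht' z' (Finset.mem_erase.2 ⟨hzz, hz'⟩) htz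
      · rintro rfl
        exact ⟨hz, ht⟩
    refine ⟨t, ?_, ?_⟩
    · have h0 := (abs_le.1 (hy (e (t, 0)))).1
      rw [payload_apply, hfilter, Finset.sum_singleton] at h0
      simp only [Fin.val_zero, pow_zero] at h0
      linarith
    · have := (abs_le.1 (hquad t)).2
      rw [hfilter, Finset.sum_singleton, ← ha, sub_self] at this
      simp only [ne_eq, OfNat.ofNat_ne_zero, not_false_eq_true, zero_pow, zero_div,
        sub_zero] at this
      linarith

open Classical in
/-- The memory of machine `a` that is encoded by `y`. -/
def decodeMemory (S : ℕ) (e : Slot × Fin 3 ↪ Fin m) (a : Fin N) (y : Fin m → ℝ) : Memory w :=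
  -- The condition determines `A`; the default `∅` plays no role for admissible messages. Positions
  -- are visible only below `S`, hence the length bound, and unused indices `τ` look like empty
  -- messages, which are excluded.
  if h : ∃ A : Memory w, ∀ msg src, (msg, src) ∈ A ↔ msg ≠ [] ∧ msg.length ≤ S ∧
      ∃ j : Fin N, (j : ℕ) = src ∧ ∃ τ : Fin S, ∀ (pos : Fin S) (v : Word w),
        (j, a, τ, pos, v) ∈ decodedItems e y ↔ msg[(pos : ℕ)]? = some v
  then h.choose else ∅

/-- Received messages can be decoded from the average over the senders. -/
theorem decodeMemory_eq_deliver {e : Slot × Fin 3 ↪ Fin m} {U : Item N S w → Finset Slot} {p : ℕ}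
    (hU : CoverFree U ((S + 1) * S)) {out : Fin N → Finset (Message w × Fin N)}
    (hout : Admissible S out)
    (hp : 32 * N * (Fintype.card (Item N S w) + 1) ^ 2 ≤ 2 ^ p) {y : Fin m → ℝ} {a : Fin N}
    (hy : ∀ k, |y k - payload e U (incomingItems S out a) k / (senders out a).card| ≤ 5 / 2 ^ p) :
    decodeMemory S e a y = MPCProtocol.deliver out a := by
  have hdec := mem_decodedItems_iff hU (hout.card_incomingItems_le a)
    (Finset.card_pos.2 (senders_nonempty out a)) ((Finset.card_le_univ _).trans (by simp)) hp hy
  have hmem : ∀ msg src, (msg, src) ∈ MPCProtocol.deliver out a ↔ msg ≠ [] ∧ msg.length ≤ S ∧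
      ∃ j : Fin N, (j : ℕ) = src ∧ ∃ τ : Fin S, ∀ (pos : Fin S) (v : Word w),
        (j, a, τ, pos, v) ∈ decodedItems e y ↔ msg[(pos : ℕ)]? = some v := by
    intro msg src
    simp only [hdec, mem_incomingItems]
    constructor
    · intro hx
      obtain ⟨j, hj, rfl⟩ := mem_deliver.1 hx
      refine ⟨hout.nonempty j _ hj, (length_le_wordCount hx).trans (hout.receive_le a), j, rfl, ?_⟩
      obtain ⟨τ, hτ, hget⟩ := List.getElem_of_mem (Finset.mem_toList.2 hj)
      have hτS : τ < S := by
        rw [Finset.length_toList] at hτ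
        exact hτ.trans_le ((card_le_wordCount (hout.nonempty j)).trans (hout.send_le j))
      have hget' : (out j).toList[τ]? = some (msg, a) := by
        rw [List.getElem?_eq_getElem hτ, hget]
      refine ⟨⟨τ, hτS⟩, fun pos v => ⟨?_, fun hv => ⟨msg, hget', hv⟩⟩⟩
      rintro ⟨msg', hmsg', hv⟩
      obtain ⟨rfl, -⟩ := Prod.mk.inj (Option.some.inj (hget'.symm.trans hmsg'))
      exact hv
    · rintro ⟨hne, hlen, j, rfl, τ, hτ⟩
      have h0 : 0 < msg.length := List.length_pos_iff.2 hne
      -- The first word shows that index `τ` belongs to a genuine message addressed to `a`.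
      obtain ⟨msg', hmsg', -⟩ := (hτ ⟨0, h0.trans_le hlen⟩ msg[0]).2 (List.getElem?_eq_getElem h0)
      have hj : (msg', a) ∈ out j := Finset.mem_toList.1 (List.mem_of_getElem? hmsg')
      have hlen' : msg'.length ≤ S := (length_le_wordCount hj).trans (hout.send_le j)
      have heq : msg = msg' := by
        refine List.ext_getElem? fun i => ?_
        by_cases hi : i < S
        · refine Option.ext fun v => ?_
          rw [← hτ ⟨i, hi⟩ v]
          constructor
          · rintro ⟨msg'', h'', hv⟩
            obtain ⟨rfl, -⟩ := Prod.mk.inj (Option.some.inj (hmsg'.symm.trans h''))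
            exact hv
          · exact fun hv => ⟨msg', hmsg', hv⟩
        · rw [List.getElem?_eq_none (by omega), List.getElem?_eq_none (by omega)]
      exact mem_deliver.2 ⟨j, heq ▸ hj, rfl⟩
  have hex : ∃ A : Memory w, ∀ msg src, (msg, src) ∈ A ↔ msg ≠ [] ∧ msg.length ≤ S ∧
      ∃ j : Fin N, (j : ℕ) = src ∧ ∃ τ : Fin S, ∀ (pos : Fin S) (v : Word w),
        (j, a, τ, pos, v) ∈ decodedItems e y ↔ msg[(pos : ℕ)]? = some v := ⟨_, hmem⟩
  rw [decodeMemory, dif_pos hex]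
  ext ⟨msg, src⟩
  rw [hex.choose_spec, hmem]

end Items

/-! ### Rounding -/

/-- Rounding to precision `p`; numbers that are too large are replaced by `0`. -/
def quantize (p : ℕ) (x : ℝ) : ℝ := if |x| ≤ 2 ^ p then (⌊x * 2 ^ p⌋ : ℝ) / 2 ^ p else 0

theorem isFixedPoint_quantize (p : ℕ) (x : ℝ) : IsFixedPoint p (quantize p x) := by
  have h2p : (0 : ℝ) < 2 ^ p := by positivity
  unfold quantize
  split_ifs with hx
  · refine ⟨?_, ⌊x * 2 ^ p⌋, by field_simp⟩
    obtain ⟨h1, h2⟩ := abs_le.1 hx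
    rw [abs_div, abs_of_pos h2p, div_le_iff₀ h2p]
    refine abs_le.2 ⟨?_, (Int.floor_le _).trans (mul_le_mul_of_nonneg_right h2 h2p.le)⟩
    have h3 : (-(2 ^ p * 2 ^ p) : ℤ) ≤ ⌊x * 2 ^ p⌋ := by
      refine Int.le_floor.2 ?_
      push_cast
      nlinarith
    exact_mod_cast h3
  · simpa using isFixedPoint_natCast (p := p) (Nat.zero_le _)

theorem abs_quantize_sub_le {p : ℕ} {x : ℝ} (hx : |x| ≤ 2 ^ p) :
    |quantize p x - x| ≤ 1 / 2 ^ p := by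
  have h2p : (0 : ℝ) < 2 ^ p := by positivity
  rw [quantize, if_pos hx, le_div_iff₀ h2p, ← abs_of_pos h2p, ← abs_mul, abs_of_pos h2p, sub_mul,
    div_mul_cancel₀ _ h2p.ne']
  have h1 := Int.floor_le (x * 2 ^ p)
  have h2 := Int.lt_floor_add_one (x * 2 ^ p)
  exact abs_le.2 ⟨by linarith, by linarith⟩

/-! ### The messages of a protocol -/

/-- The position `⌊j / s⌋`. -/
def divFin {N : ℕ} (j : Fin N) (s : ℕ) : Fin N :=
  ⟨(j : ℕ) / s, (Nat.div_le_self _ _).trans_lt j.isLt⟩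

namespace MPCProtocol

variable {n nout q s w R N S : ℕ}

/-- The messages sent by the positions of a transformer: first, input tokens are sent to the
machines responsible for them; then the rounds of the protocol follow. -/
def transmissions (π : MPCProtocol n nout q s w R) (hqN : q ≤ N) (inp : Fin n → Word w) :
    Fin (R + 1) → Fin N → Finset (Message w × Fin N) :=
  Fin.cases
    (fun j => if h : (j : ℕ) < n then {([inp ⟨j, h⟩], divFin j s)} else ∅)
    (fun r j => if h : (j : ℕ) < q then
      (π.outgoing inp r ⟨j, h⟩).image (Prod.map id (Fin.castLE hqN)) else ∅)

variable (π : MPCProtocol n nout q s w R) (hqN : q ≤ N) (inp : Fin n → Word w)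

theorem mem_transmissions_zero {j a : Fin N} {msg : Message w} :
    (msg, a) ∈ π.transmissions hqN inp 0 j ↔
      ∃ h : (j : ℕ) < n, msg = [inp ⟨j, h⟩] ∧ a = divFin j s := by
  simp only [transmissions, Fin.cases_zero]
  split_ifs with h <;> simp [h]

theorem mem_transmissions_succ {r : Fin R} {j a : Fin N} {msg : Message w} :
    (msg, a) ∈ π.transmissions hqN inp r.succ j ↔
      ∃ (h : (j : ℕ) < q) (b : Fin q), (msg, b) ∈ π.outgoing inp r ⟨j, h⟩ ∧
        a = Fin.castLE hqN b := by
  simp only [transmissions, Fin.cases_succ]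
  split_ifs with h
  · simp only [Finset.mem_image, Prod.exists, Prod.map_apply, id_eq, Prod.mk.injEq, h,
      exists_true_left]
    constructor
    · rintro ⟨msg', b, hb, rfl, rfl⟩
      exact ⟨b, hb, rfl⟩
    · rintro ⟨b, hb, rfl⟩
      exact ⟨msg, b, hb, rfl, rfl⟩
  · simp [h]

theorem memory_zero (a : Fin q) : π.memory inp 0 a = initialMemory s inp a := rfl

theorem memory_succ (r : Fin R) (a : Fin q) :
    π.memory inp r.succ a = deliver (π.outgoing inp r) a := rfl

/-- Distributing the input counts as transmission `0`, so transmission `ℓ` produces the memories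
after `ℓ` rounds. -/
theorem deliver_transmissions (hnN : n ≤ N) (ℓ : Fin (R + 1)) (a : Fin q) :
    deliver (π.transmissions hqN inp ℓ) (Fin.castLE hqN a) = π.memory inp ℓ a := by
  ext ⟨msg, src⟩
  rw [mem_deliver]
  induction ℓ using Fin.cases with
  | zero =>
    simp only [mem_transmissions_zero, memory_zero, initialMemory, Finset.mem_image,
      Finset.mem_filter, Finset.mem_univ, true_and, Prod.mk.injEq]
    constructor
    · rintro ⟨j, ⟨h, rfl, ha⟩, rfl⟩
      exact ⟨⟨j, h⟩, (congrArg Fin.val ha).symm, rfl, rfl⟩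
    · rintro ⟨ι, ha, rfl, rfl⟩
      exact ⟨Fin.castLE hnN ι, ⟨ι.isLt, rfl, Fin.ext ha.symm⟩, rfl⟩
  | succ r =>
    rw [memory_succ, mem_deliver]
    simp only [mem_transmissions_succ]
    constructor
    · rintro ⟨j, ⟨h, b, hb, hab⟩, rfl⟩
      obtain rfl : a = b := Fin.castLE_injective hqN hab
      exact ⟨⟨j, h⟩, hb, rfl⟩
    · rintro ⟨j, hj, rfl⟩
      exact ⟨Fin.castLE hqN j, ⟨j.isLt, a, hj, rfl⟩, rfl⟩

/-- Positions that are not machines must obey the bound on received words too; they receive nothing.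
-/
theorem deliver_transmissions_eq_empty (ℓ : Fin (R + 1)) {a : Fin N}
    (ha : q ≤ a) : deliver (π.transmissions hqN inp ℓ) a = ∅ := by
  refine Finset.eq_empty_of_forall_notMem ?_
  rintro ⟨msg, src⟩ hx
  obtain ⟨j, hj, -⟩ := mem_deliver.1 hx
  induction ℓ using Fin.cases with
  | zero =>
    obtain ⟨h, -, rfl⟩ := (mem_transmissions_zero _ _ _).1 hj
    refine absurd ha (not_le.2 ?_)
    exact Nat.div_lt_of_lt_mul (h.trans_le (π.input_fits.trans (Nat.mul_comm q s).le))
  | succ r =>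
    obtain ⟨h, b, -, rfl⟩ := (mem_transmissions_succ _ _ _).1 hj
    exact absurd ha (not_le.2 b.isLt)

theorem wordCount_initialMemory_le (hs : 0 < s) (a : Fin q) :
    wordCount (initialMemory s inp a) ≤ s := by
  have hlen : ∀ x ∈ initialMemory s inp a, x.1.length = 1 := by
    intro x hx
    obtain ⟨ι, -, rfl⟩ := Finset.mem_image.1 hx
    rfl
  rw [wordCount, Finset.sum_congr rfl hlen, ← Finset.card_eq_sum_ones]
  refine Finset.card_image_le.trans ?_
  calc (Finset.univ.filter fun ι : Fin n => (ι : ℕ) / s = a).card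
      ≤ (Finset.Ico (s * a) (s * a + s)).card := by
        refine Finset.card_le_card_of_injOn Fin.val ?_ Fin.val_injective.injOn
        intro ι hι
        have hι' : (ι : ℕ) / s = a := by simpa using hι
        have h1 := Nat.div_add_mod (ι : ℕ) s
        have h2 := Nat.mod_lt (ι : ℕ) hs
        rw [hι'] at h1
        simp only [Finset.coe_Ico, Set.mem_Ico]
        omega
    _ = s := by simp

variable {π}

theorem Valid.admissible_transmissions (hπ : π.Valid) (hnN : n ≤ N) (hs : 0 < s) (hsS : s ≤ S)
    (ℓ : Fin (R + 1)) : Admissible S (π.transmissions hqN inp ℓ) where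
  nonempty := by
    rintro j ⟨msg, a⟩ hx
    induction ℓ using Fin.cases with
    | zero =>
      obtain ⟨h, rfl, -⟩ := (mem_transmissions_zero _ _ _).1 hx
      simp
    | succ r =>
      obtain ⟨h, b, hb, -⟩ := (mem_transmissions_succ _ _ _).1 hx
      exact hπ.nonempty inp r _ _ hb
  send_le := by
    intro j
    refine le_trans ?_ hsS
    induction ℓ using Fin.cases with
    | zero =>
      simp only [transmissions, Fin.cases_zero]
      split_ifs with h
      · simpa [wordCount] using Nat.succ_le_of_lt hs
      · simp [wordCount]
    | succ r =>
      simp only [transmissions, Fin.cases_succ]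
      split_ifs with h
      · have hinj : Function.Injective (Prod.map (id : Message w → Message w) (Fin.castLE hqN)) :=
          Function.injective_id.prodMap (Fin.castLE_injective hqN)
        refine le_trans (le_of_eq ?_) (hπ.send_le inp r ⟨j, h⟩)
        rw [wordCount, Finset.sum_image hinj.injOn]
        rfl
      · simp [wordCount]
  receive_le := by
    intro a
    refine le_trans ?_ hsS
    by_cases ha : (a : ℕ) < q
    · have := π.deliver_transmissions hqN inp hnN ℓ ⟨a, ha⟩
      rw [show Fin.castLE hqN ⟨a, ha⟩ = a from rfl] at this
      rw [this]
      induction ℓ using Fin.cases with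
      | zero => exact wordCount_initialMemory_le inp hs _
      | succ r => exact hπ.receive_le inp r _
    · rw [deliver_transmissions_eq_empty π hqN inp ℓ (not_lt.1 ha)]
      simp [wordCount]

end MPCProtocol

/-! ### The simulating transformer -/

section Simulation

variable {n nout q s w R N m p S : ℕ} {Ω : Type*} {Slot : Type} [DecidableEq Slot]

/-- The position whose memory is held by position `i` after layer `ℓ`. -/
def layerAddress (s : ℕ) (ℓ : Fin (R + 1)) (i : Fin N) : Fin N :=
  -- Several positions may query the same address, so the last layer can copy the final memory of a
  -- machine to all of its output positions without an additional layer.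
  if ℓ = Fin.last R then divFin i s else i

/-- The messages emitted in layer `ℓ` by position `j` with embedding `x`. -/
def layerMessages (π : RandomizedMPCProtocol n nout q s w R Ω) (S : ℕ) (hqN : q ≤ N)
    (e : Slot × Fin 3 ↪ Fin m) (k₀ : Fin m) (ρ : Fin R → Fin q → Ω) :
    Fin (R + 1) → Fin N → (Fin m → ℝ) → Finset (Message w × Fin N) :=
  Fin.cases
    -- The initial embedding is exact, so the floor of coordinate `k₀` is the input word.
    (fun j x => if (j : ℕ) < n then {([((⌊x k₀⌋₊ : ℕ) : Word w)], divFin j s)} else ∅)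
    (fun r j x => if h : (j : ℕ) < q then
      (π.compute r ⟨j, h⟩ (ρ r ⟨j, h⟩) (decodeMemory S e j x)).image
        (Prod.map id (Fin.castLE hqN)) else ∅)

/-- The transformer that simulates a protocol. In each layer, the first head routes messages, and
the second one erases the previous embedding. -/
def simulator (π : RandomizedMPCProtocol n nout q s w R Ω) (S p : ℕ) (hqN : q ≤ N)
    (e : Slot × Fin 3 ↪ Fin m) (k₀ : Fin m) (U : Fin N → Finset Slot)
    (U' : Item N S w → Finset Slot) (ρ : Fin R → Fin q → Ω) : Transformer N m (R + 1) 2 where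
  head ℓ h := if h = 0 then
      routingHead p ((Function.Embedding.sectL Slot (0 : Fin 3)).trans e) U (layerAddress s ℓ)
        (fun j x => destinations j (layerMessages π S hqN e k₀ ρ ℓ j x))
        (fun j x => payload e U' (itemsOf S j (layerMessages π S hqN e k₀ ρ ℓ j x)))
    else
      routingHead p ((Function.Embedding.sectL Slot (0 : Fin 3)).trans e) U id (fun j _ => {j})
        (fun _ x k => -quantize p (x k))
  mlp i x := if h : (i : ℕ) < nout then
      ((π.decode ⟨i, h⟩ (decodeMemory S e (divFin i s) x)).val : ℝ) else 0

theorem usesSeedsLocally_simulator (π : RandomizedMPCProtocol n nout q s w R Ω) (hqN : q ≤ N)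
    (e : Slot × Fin 3 ↪ Fin m) (k₀ : Fin m) (U : Fin N → Finset Slot)
    (U' : Item N S w → Finset Slot) : UsesSeedsLocally (simulator π S p hqN e k₀ U U') := by
  intro ρ ρ'
  refine ⟨rfl, fun ℓ h i hρ => ?_⟩
  have hmsg : layerMessages π S hqN e k₀ ρ ℓ i = layerMessages π S hqN e k₀ ρ' ℓ i := by
    induction ℓ using Fin.cases with
    | zero => rfl
    | succ r =>
      funext x
      simp only [layerMessages, Fin.cases_succ]
      split_ifs with hi
      · rw [hρ r ⟨i, hi⟩ rfl rfl]
      · rfl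
  simp only [simulator]
  split_ifs
  · simp only [routingHead, hmsg, and_self]
  · exact ⟨rfl, rfl, rfl⟩

theorem simulator_hasPrecision (π : RandomizedMPCProtocol n nout q s w R Ω) (hqN : q ≤ N)
    (e : Slot × Fin 3 ↪ Fin m) (k₀ : Fin m) (U : Fin N → Finset Slot)
    (U' : Item N S w → Finset Slot) (ρ : Fin R → Fin q → Ω)
    (hp : Fintype.card (Item N S w) ^ 3 ≤ 2 ^ p) :
    (simulator π S p hqN e k₀ U U' ρ).HasPrecision p := by
  intro ℓ h
  simp only [simulator]
  split_ifs
  · refine routingHead_hasPrecision fun j x k => ?_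
    obtain ⟨c, hc, h⟩ := exists_payload_eq_natCast e U'
      (itemsOf S j (layerMessages π S hqN e k₀ ρ ℓ j x)) k
    rw [h]
    exact isFixedPoint_natCast (hc.trans hp)
  · exact routingHead_hasPrecision fun j x k => (isFixedPoint_quantize p _).neg

/-- Rows must stay in the range where `quantize` is accurate, or they could not be erased in the
next layer; the summand `5` absorbs the error. -/
theorem abs_le_of_abs_sub_encoding_le {e : Slot × Fin 3 ↪ Fin m} {U' : Item N S w → Finset Slot}
    (hp : Fintype.card (Item N S w) ^ 3 + 5 ≤ 2 ^ p) {I : Finset (Item N S w)} {κ : ℕ}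
    (hκ : 0 < κ) {x : ℝ} {k : Fin m} (hx : |x - payload e U' I k / κ| ≤ 5 / 2 ^ p) :
    |x| ≤ 2 ^ p := by
  obtain ⟨c, hc, h⟩ := exists_payload_eq_natCast e U' I k
  have h1 : |(payload e U' I k / κ : ℝ)| ≤ c := by
    rw [h, abs_of_nonneg (by positivity)]
    exact div_le_self (Nat.cast_nonneg c) (by exact_mod_cast hκ)
  have h2 : (5 : ℝ) / 2 ^ p ≤ 5 := div_le_self (by norm_num) (one_le_pow₀ (by norm_num))
  have h3 : (c : ℝ) + 5 ≤ 2 ^ p := by exact_mod_cast (Nat.add_le_add_right hc 5).trans hp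
  have h4 := abs_sub_abs_le_abs_sub x (payload e U' I k / κ)
  linarith

variable [Fintype Slot]

/-- One layer of the simulation replaces the embeddings by encodings of the messages received. -/
theorem abs_simulator_layer_sub_le {π : RandomizedMPCProtocol n nout q s w R Ω} {hqN : q ≤ N}
    {e : Slot × Fin 3 ↪ Fin m} {k₀ : Fin m} {U : Fin N → Finset Slot}
    {U' : Item N S w → Finset Slot} {ρ : Fin R → Fin q → Ω}
    (hp4 : 4 ≤ p) (hN : N ≤ 2 ^ p) (hp : Fintype.card (Item N S w) ^ 3 ≤ 2 ^ p)
    (hU : CoverFree U (S + 1))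
    {F : Fin (R + 1) → Fin 2 → Matrix (Fin N) (Fin m) ℝ → Matrix (Fin N) (Fin m) ℝ}
    (hF : (simulator π S p hqN e k₀ U U' ρ).IsValidImplementation p F) (ℓ : Fin (R + 1))
    {out : Fin N → Finset (Message w × Fin N)} (hout : Admissible S out)
    {X : Matrix (Fin N) (Fin m) ℝ} (hX : ∀ i k, |X i k| ≤ 2 ^ p)
    (hmsg : ∀ j, layerMessages π S hqN e k₀ ρ ℓ j (X j) = out j) (i : Fin N) (k : Fin m) :
    |(X + ∑ h, F ℓ h X) i k - payload e U' (incomingItems S out (layerAddress s ℓ i)) k /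
      (senders out (layerAddress s ℓ i)).card| ≤ 5 / 2 ^ p := by
  set a := layerAddress s ℓ i with ha
  have h0 := hF ℓ 0 X i k
  have h1 := hF ℓ 1 X i k
  simp only [simulator, if_true, one_ne_zero, if_false] at h0 h1
  have h0' := abs_routingHead_eval_sub_average_le (r := S + 1) (X := X) hp4 hN hU
    (e := (Function.Embedding.sectL Slot (0 : Fin 3)).trans e) (addr := layerAddress s ℓ)
    (dst := fun j x => destinations j (layerMessages π S hqN e k₀ ρ ℓ j x))
    (val := fun j x => payload e U' (itemsOf S j (layerMessages π S hqN e k₀ ρ ℓ j x)))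
    (fun j => by rw [hmsg]; exact hout.card_destinations_le j)
    (fun j k => by
      obtain ⟨c, hc, h⟩ := exists_payload_eq_natCast e U'
        (itemsOf S j (layerMessages π S hqN e k₀ ρ ℓ j (X j))) k
      rw [h, abs_of_nonneg (Nat.cast_nonneg c)]
      exact_mod_cast hc.trans hp)
    i (S := senders out a) (fun j => by rw [hmsg, mem_senders]) (senders_nonempty out a) k
  have h1' := abs_routingHead_eval_sub_average_le (r := S + 1) (X := X) hp4 hN hU
    (e := (Function.Embedding.sectL Slot (0 : Fin 3)).trans e) (addr := id)
    (dst := fun j _ => {j}) (val := fun _ x k => -quantize p (x k))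
    (fun j => by simp)
    (fun j k => ((isFixedPoint_quantize p _).neg).1)
    i (S := {i}) (fun j => by simp [eq_comm]) (Finset.singleton_nonempty i) k
  have hq := abs_quantize_sub_le (hX i k)
  simp only [hmsg, sum_payload_itemsOf] at h0'
  rw [Finset.sum_singleton, Finset.card_singleton, Nat.cast_one, div_one] at h1'
  rw [Fin.sum_univ_two, Matrix.add_apply, Matrix.add_apply]
  -- The five units: softmax against average and implementation error, for each of the two heads,
  -- and the rounding of the erased row.
  have h5 : (5 : ℝ) / 2 ^ p = 5 * (1 / 2 ^ p) := by ring
  rw [h5]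
  rw [abs_le] at h0 h1 h0' h1' hq ⊢
  constructor <;> linarith [h0.1, h0.2, h1.1, h1.2, h0'.1, h0'.2, h1'.1, h1'.2, hq.1, hq.2]

/-- Induction over the layers with two invariants: rows are bounded by `2 ^ p`, and after each layer
they are `5 / 2 ^ p`-close to the encoding of the true messages of the protocol. Exact decoding
makes the next messages the true ones, so the same error bound recurs. -/
theorem simulator_simulates (π : RandomizedMPCProtocol n nout q s w R Ω) {hqN : q ≤ N}
    {e : Slot × Fin 3 ↪ Fin m} {k₀ : Fin m} (hk₀ : (k₀ : ℕ) = 0) {U : Fin N → Finset Slot}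
    {U' : Item N S w → Finset Slot} (hnN : n ≤ N) (hs : 0 < s) (hsS : s ≤ S)
    (hp4 : 4 ≤ p) (hw : 2 ^ w ≤ 2 ^ p) (hp : Fintype.card (Item N S w) ^ 3 + 5 ≤ 2 ^ p)
    (hp' : 32 * N * (Fintype.card (Item N S w) + 1) ^ 2 ≤ 2 ^ p)
    (hU : CoverFree U (S + 1)) (hU' : CoverFree U' ((S + 1) * S)) (ρ : Fin R → Fin q → Ω)
    (hπ : (π.fixSeeds ρ).Valid) :
    (simulator π S p hqN e k₀ U U' ρ).Simulates p (π.fixSeeds ρ).output := by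
  have hp3 : Fintype.card (Item N S w) ^ 3 ≤ 2 ^ p := (Nat.le_add_right _ _).trans hp
  have hN : N ≤ 2 ^ p := by
    refine le_trans ?_ hp'
    nlinarith [Nat.zero_le (N * Fintype.card (Item N S w)),
      Nat.zero_le (N * Fintype.card (Item N S w) ^ 2)]
  refine ⟨simulator_hasPrecision π hqN e k₀ U U' ρ hp3, fun F hF inp => ?_⟩
  have hadm : ∀ ℓ, Admissible S ((π.fixSeeds ρ).transmissions hqN inp ℓ) :=
    hπ.admissible_transmissions hqN inp hnN hs hsS
  have hdec : ∀ (ℓ : Fin (R + 1)) (a : Fin N) (x : Fin m → ℝ),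
      (∀ k, |x k - payload e U'
        (incomingItems S ((π.fixSeeds ρ).transmissions hqN inp ℓ) a) k /
        (senders ((π.fixSeeds ρ).transmissions hqN inp ℓ) a).card| ≤ 5 / 2 ^ p) →
      ∀ ha : (a : ℕ) < q, decodeMemory S e a x = (π.fixSeeds ρ).memory inp ℓ ⟨a, ha⟩ := by
    intro ℓ a x hx ha
    rw [decodeMemory_eq_deliver hU' (hadm ℓ) hp' hx,
      ← (π.fixSeeds ρ).deliver_transmissions hqN inp hnN]
    rfl
  have hinit : ∀ i k, |Transformer.initialEmbedding m (inputTokens N inp) i k| ≤ 2 ^ p := by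
    intro i k
    simp only [Transformer.initialEmbedding, inputTokens, Matrix.of_apply]
    split_ifs with hk hi
    · rw [abs_of_nonneg (Nat.cast_nonneg _)]
      exact_mod_cast ((ZMod.val_lt _).le.trans hw)
    · simp
    · simp
  have hmain : ∀ ℓ : Fin (R + 1 + 1),
      (∀ i k, |Transformer.embedding F (inputTokens N inp) ℓ i k| ≤ 2 ^ p) ∧
      ∀ ℓ' : Fin (R + 1), ℓ = ℓ'.succ → ∀ i k,
        |Transformer.embedding F (inputTokens N inp) ℓ i k - payload e U'
          (incomingItems S ((π.fixSeeds ρ).transmissions hqN inp ℓ') (layerAddress s ℓ' i)) k /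
          (senders ((π.fixSeeds ρ).transmissions hqN inp ℓ') (layerAddress s ℓ' i)).card|
          ≤ 5 / 2 ^ p := by
    intro ℓ
    induction ℓ using Fin.induction with
    | zero => exact ⟨hinit, fun ℓ' h => absurd h (Fin.succ_ne_zero ℓ').symm⟩
    | succ ℓ ih =>
      obtain ⟨hbound, happrox⟩ := ih
      have hmsg : ∀ j, layerMessages π S hqN e k₀ ρ ℓ j
          (Transformer.embedding F (inputTokens N inp) ℓ.castSucc j) =
          (π.fixSeeds ρ).transmissions hqN inp ℓ j := by
        intro j
        induction ℓ using Fin.cases with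
        | zero =>
          simp only [layerMessages, MPCProtocol.transmissions, Fin.cases_zero]
          split_ifs with hj
          · have hx : Transformer.embedding F (inputTokens N inp) (Fin.castSucc 0) j k₀ =
                ((inp ⟨j, hj⟩).val : ℝ) := by
              change Transformer.initialEmbedding m (inputTokens N inp) j k₀ = _
              simp [Transformer.initialEmbedding, inputTokens, hk₀, hj]
            rw [hx, Nat.floor_natCast, ZMod.natCast_zmod_val]
          · rfl
        | succ r =>
          simp only [layerMessages, MPCProtocol.transmissions, Fin.cases_succ]
          split_ifs with hj
          · have hr : layerAddress s r.castSucc j = j :=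
              if_neg (Fin.castSucc_lt_last r).ne
            have := happrox r.castSucc (Fin.succ_castSucc r).symm j
            rw [hr] at this
            rw [hdec r.castSucc j _ this hj]
            rfl
          · rfl
      have hstep := abs_simulator_layer_sub_le hp4 hN hp3 hU hF ℓ (hadm ℓ) hbound hmsg
      refine ⟨fun i k => abs_le_of_abs_sub_encoding_le hp (Finset.card_pos.2 (senders_nonempty _ _))
        (hstep i k), fun ℓ' h => ?_⟩
      obtain rfl : ℓ = ℓ' := Fin.succ_injective _ h
      exact hstep
  refine ⟨fun ℓ => (hmain ℓ).1, fun ι i hi => ?_⟩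
  have hfin := (hmain (Fin.last (R + 1))).2 (Fin.last R) (Fin.succ_last R).symm i
  have hlast : layerAddress s (Fin.last R) i = divFin i s := if_pos rfl
  rw [hlast] at hfin
  have hι : (i : ℕ) < nout := hi ▸ ι.isLt
  have hq : ((divFin i s : Fin N) : ℕ) < q := by
    have := ((π.fixSeeds ρ).outputMachine ι).isLt
    simpa [MPCProtocol.outputMachine, divFin, hi] using this
  rw [Transformer.output]
  simp only [simulator, dif_pos hι]
  rw [hdec _ _ _ hfin hq]
  obtain rfl : ι = ⟨i, hι⟩ := Fin.ext hi.symm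
  rfl

end Simulation

/-! ### Sizes -/

theorem card_item (N S w : ℕ) :
    Fintype.card (Item N S w) = N * (N * (S * (S * 2 ^ w))) := by
  simp [Item, Fintype.card_prod, ZMod.card]

theorem mul_rpow_le_pow {c x a : ℝ} {D : ℕ} (hx : 1 ≤ x) (hc : c ≤ x) (ha : a + 1 ≤ D) :
    c * x ^ a ≤ x ^ D := by
  have hx0 : 0 < x := one_pos.trans_le hx
  calc c * x ^ a ≤ x * x ^ a := by gcongr
    _ = x ^ (a + 1) := by rw [Real.rpow_add_one hx0.ne', mul_comm]
    _ ≤ x ^ (D : ℝ) := Real.rpow_le_rpow_of_exponent_le hx ha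
    _ = x ^ D := Real.rpow_natCast x D

theorem log_le_clog {n : ℕ} (hn : 0 < n) : Real.log n ≤ Nat.clog 2 n := by
  have h1 : (n : ℝ) ≤ 2 ^ Nat.clog 2 n := by exact_mod_cast Nat.le_pow_clog one_lt_two n
  have h2 := Real.log_le_log (by exact_mod_cast hn) h1
  rw [Real.log_pow] at h2
  have h3 := Real.log_two_lt_d9
  have h4 : (0 : ℝ) ≤ Nat.clog 2 n := Nat.cast_nonneg _
  nlinarith

theorem clog_le_three_mul_log {n : ℕ} (hn : 1 ≤ Real.log n) :
    (Nat.clog 2 n : ℝ) ≤ 3 * Real.log n := by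
  have hn1 : 1 < n := by
    by_contra! h
    interval_cases n <;> simp at hn <;> linarith
  have h1 : 2 ^ (Nat.clog 2 n).pred < n := Nat.pow_pred_clog_lt_self one_lt_two hn1
  have h2 : ((2 : ℝ) ^ (Nat.clog 2 n).pred) < n := by exact_mod_cast h1
  have h3 := Real.log_le_log (by positivity) h2.le
  rw [Real.log_pow] at h3
  have h4 := Real.log_two_gt_d9
  have h5 : (Nat.clog 2 n : ℝ) ≤ (Nat.clog 2 n).pred + 1 := by
    exact_mod_cast Nat.le_succ_of_pred_le le_rfl
  have h6 : (0 : ℝ) ≤ (Nat.clog 2 n).pred := Nat.cast_nonneg _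
  nlinarith

/-- The cardinalities of the simulation fit into a precision of `O(log n)`. -/
theorem precision_bounds {n N w D Z : ℕ} (hn : 2 ≤ n) (hN : N ≤ n ^ D) (hw : 2 ^ w ≤ n ^ D)
    (hD : 1 ≤ D) (hZ : Z ≤ n ^ (5 * D)) :
    4 ≤ (15 * D + 7) * Nat.clog 2 n ∧ 2 ^ w ≤ 2 ^ ((15 * D + 7) * Nat.clog 2 n) ∧
      Z ^ 3 + 5 ≤ 2 ^ ((15 * D + 7) * Nat.clog 2 n) ∧
      32 * N * (Z + 1) ^ 2 ≤ 2 ^ ((15 * D + 7) * Nat.clog 2 n) := by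
  have hb : 1 ≤ Nat.clog 2 n := Nat.clog_pos one_lt_two hn
  have hpow : ∀ j, j ≤ 15 * D + 7 → n ^ j ≤ 2 ^ ((15 * D + 7) * Nat.clog 2 n) := by
    intro j hj
    calc n ^ j ≤ n ^ (15 * D + 7) := Nat.pow_le_pow_right (by omega) hj
      _ ≤ (2 ^ Nat.clog 2 n) ^ (15 * D + 7) :=
        Nat.pow_le_pow_left (Nat.le_pow_clog one_lt_two n) _
      _ = _ := by rw [← pow_mul, mul_comm]
  have h2 : ∀ j, 2 ^ j ≤ n ^ j := fun j => Nat.pow_le_pow_left hn j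
  have hpos : ∀ j, 1 ≤ n ^ j := fun j => Nat.one_le_pow _ _ (by omega)
  refine ⟨by nlinarith, hw.trans (hpow D (by omega)), ?_, ?_⟩
  -- The factor `n ^ 3 ≥ 8` absorbs the summand `5`.
  · refine le_trans ?_ (hpow (15 * D + 3) (by omega))
    have h3 : Z ^ 3 ≤ n ^ (15 * D) := by
      calc Z ^ 3 ≤ (n ^ (5 * D)) ^ 3 := Nat.pow_le_pow_left hZ 3
        _ = n ^ (15 * D) := by rw [← pow_mul]; congr 1; ring
    rw [pow_add]
    have h8 : 8 ≤ n ^ 3 := h2 3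
    nlinarith [hpos (15 * D)]
  -- The exponents bound `32 = 2 ^ 5`, `N` and `(Z + 1) ^ 2` in turn; they add up to `11 * D + 7`.
  · refine le_trans ?_ (hpow (5 + D + 2 * (5 * D + 1)) (by omega))
    rw [pow_add, pow_add, mul_comm 2 (5 * D + 1), pow_mul n (5 * D + 1) 2]
    have hZ1 : Z + 1 ≤ n ^ (5 * D + 1) := by
      rw [pow_succ]
      nlinarith [hpos (5 * D)]
    exact Nat.mul_le_mul (Nat.mul_le_mul (h2 5) hN) (Nat.pow_le_pow_left hZ1 2)

/-- The dimension is `3 * P ^ 2`, with `P` of order `n ^ (2 * δ)`. The lower bound on `n` makes `log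
n` and `log (log n)` at least `1`, so that the spare logarithm and the two heads fit. -/
theorem transformerScaling_of_le {δ A : ℝ} {n S P k c : ℕ} [NeZero P] (hA : 0 < A)
    (hn : Real.exp (Real.exp 1) ≤ n) (hc : 1 ≤ c) (hS : (S : ℝ) + 1 ≤ (A + 3) * (n : ℝ) ^ δ)
    (hP : P ≤ 2 * ((S + 1) * (S + 1) * k)) :
    TransformerScaling δ (12 * k ^ 2 * (A + 3) ^ 4 + 3 * c + 2) n
      (Fintype.card ((ZMod P × ZMod P) × Fin 3)) 2 (c * Nat.clog 2 n) := by
  obtain ⟨C₁, hC₁⟩ : ∃ C₁ : ℝ, C₁ = 12 * k ^ 2 * (A + 3) ^ 4 := ⟨_, rfl⟩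
  rw [← hC₁]
  have hC₁0 : 0 ≤ C₁ := by rw [hC₁]; positivity
  have hc1 : (1 : ℝ) ≤ c := by exact_mod_cast hc
  have hn0 : (0 : ℝ) < n := (Real.exp_pos _).trans_le hn
  have hlog : Real.exp 1 ≤ Real.log n := (Real.le_log_iff_exp_le hn0).2 hn
  have hlog1 : 1 ≤ Real.log n := (Real.one_le_exp zero_le_one).trans hlog
  have hloglog : 1 ≤ Real.log (Real.log n) := (Real.le_log_iff_exp_le (by linarith)).2 hlog
  refine ⟨?_, ?_, ?_, ?_⟩
  · have h1 : (P : ℝ) ≤ 2 * ((S + 1) * (S + 1) * k) := by exact_mod_cast hP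
    have h2 : (P : ℝ) ≤ 2 * (((A + 3) * (n : ℝ) ^ δ) * ((A + 3) * (n : ℝ) ^ δ) * k) := by
      refine h1.trans ?_
      gcongr
    have h3 : (n : ℝ) ^ (4 * δ) = ((n : ℝ) ^ δ) ^ 4 := by
      rw [mul_comm, ← Real.rpow_mul_natCast hn0.le]
      norm_num
    have h4 : (Fintype.card ((ZMod P × ZMod P) × Fin 3) : ℝ) = 3 * (P : ℝ) ^ 2 := by
      rw [Fintype.card_prod, Fintype.card_prod, ZMod.card, Fintype.card_fin]
      push_cast
      ring
    calc (Fintype.card ((ZMod P × ZMod P) × Fin 3) : ℝ) = 3 * (P : ℝ) ^ 2 := h4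
      _ ≤ 3 * (2 * (((A + 3) * (n : ℝ) ^ δ) * ((A + 3) * (n : ℝ) ^ δ) * k)) ^ 2 := by gcongr
      _ = C₁ * ((n : ℝ) ^ (4 * δ) * 1) := by rw [hC₁, h3]; ring
      _ ≤ (C₁ + 3 * c + 2) * ((n : ℝ) ^ (4 * δ) * Real.log n) := by
        gcongr
        linarith
  · push_cast
    nlinarith
  · have h1 : (C₁ + 3 * c + 2)⁻¹ ≤ 1 := inv_le_one_of_one_le₀ (by linarith)
    push_cast
    calc (C₁ + 3 * c + 2)⁻¹ * Real.log n ≤ 1 * Nat.clog 2 n := by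
          gcongr
          exact log_le_clog (by exact_mod_cast hn0)
      _ ≤ c * Nat.clog 2 n := by gcongr
  · push_cast
    calc (c : ℝ) * Nat.clog 2 n ≤ c * (3 * Real.log n) := by
          gcongr
          exact clog_le_three_mul_log hlog1
      _ = 3 * c * Real.log n := by ring
      _ ≤ (C₁ + 3 * c + 2) * Real.log n := by
        gcongr
        linarith

/-- All cardinalities are at most fixed powers of `n`, while the field already has at least `n ^ δ`
elements. Hence a number `k` of coefficients that depends only on the constants suffices to index
both codes. -/
theorem exists_simulation (γ δ A : ℝ) (hγ : 0 < γ) (hδ : 0 < δ) (hA : 0 < A) :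
    ∃ (C : ℝ) (n₀ : ℕ), 0 < C ∧
      ∀ n nout q s w R N : ℕ, n₀ ≤ n → N = max n q → MPCScaling γ δ A n q s w →
        ∀ (Ω : Type*) (π : RandomizedMPCProtocol n nout q s w R Ω),
          (∀ ρ, (π.fixSeeds ρ).Valid) →
          ∃ m H p : ℕ, TransformerScaling δ C n m H p ∧
            ∃ T : (Fin R → Fin q → Ω) → Transformer N m (R + 1) H,
              UsesSeedsLocally T ∧ ∀ ρ, (T ρ).Simulates p (π.fixSeeds ρ).output := by
  -- With this exponent, `n ^ D` bounds `S`, `N` and `2 ^ w`, the constant `A` included; a product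
  -- of five such factors bounds the number of items.
  obtain ⟨D, hD⟩ := exists_nat_ge (γ + δ + A + 3)
  have hD1 : 1 ≤ D := by
    have : (1 : ℝ) ≤ D := by linarith
    exact_mod_cast this
  -- This makes `(n ^ δ) ^ k ≥ n ^ (5 * D)`.
  obtain ⟨k, hk⟩ := exists_nat_ge (5 * D / δ)
  have hDpos : (0 : ℝ) < D := by exact_mod_cast hD1
  have hk1 : 0 < k := by
    have : (0 : ℝ) < k := lt_of_lt_of_le (by positivity) hk
    exact_mod_cast this
  obtain ⟨n₀, hn₀⟩ := exists_nat_ge (A + 2 + Real.exp (Real.exp 1))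
  refine ⟨12 * k ^ 2 * (A + 3) ^ 4 + 3 * (15 * D + 7 : ℕ) + 2, n₀, by positivity, ?_⟩
  intro n nout q s w R N hn hN hscale Ω π hπ
  have hn' : A + 2 + Real.exp (Real.exp 1) ≤ n := hn₀.trans (by exact_mod_cast hn)
  have hexp := Real.exp_pos (Real.exp 1)
  have hn2 : 2 ≤ n := by
    have : (2 : ℝ) ≤ n := by linarith
    exact_mod_cast this
  have hn1 : (1 : ℝ) ≤ n := by linarith
  have hn0 : (0 : ℝ) < n := by linarith
  have hδ1 : (1 : ℝ) ≤ (n : ℝ) ^ δ := Real.one_le_rpow hn1 hδ.le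
  -- the memory size
  obtain ⟨S, hS⟩ : ∃ S, S = ⌈(A + 1) * (n : ℝ) ^ δ⌉₊ := ⟨_, rfl⟩
  have hSlow : (A + 1) * (n : ℝ) ^ δ ≤ S := hS ▸ Nat.le_ceil _
  have hSupp : (S : ℝ) + 1 ≤ (A + 3) * (n : ℝ) ^ δ := by
    have := Nat.ceil_lt_add_one (by positivity : 0 ≤ (A + 1) * (n : ℝ) ^ δ)
    rw [← hS] at this
    nlinarith
  have hSδ : (n : ℝ) ^ δ ≤ S := by nlinarith
  have hsS : s ≤ S := by
    have : (s : ℝ) ≤ S := hscale.memory_le.trans (by nlinarith)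
    exact_mod_cast this
  have hs : 0 < s := by
    have hfit := π.input_fits
    rcases Nat.eq_zero_or_pos s with rfl | h
    · omega
    · exact h
  -- polynomial bounds
  have hSD : S ≤ n ^ D := by
    have h1 : (A + 2) * (n : ℝ) ^ δ ≤ (n : ℝ) ^ D :=
      mul_rpow_le_pow hn1 (by linarith) (by linarith)
    have h2 := Nat.ceil_lt_add_one (by positivity : 0 ≤ (A + 1) * (n : ℝ) ^ δ)
    rw [← hS] at h2
    have : (S : ℝ) ≤ (n : ℝ) ^ D := by nlinarith
    exact_mod_cast this
  have hND : N ≤ n ^ D := by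
    rw [hN]
    refine max_le (Nat.le_self_pow (by omega) n) ?_
    have : (q : ℝ) ≤ (n : ℝ) ^ D :=
      hscale.machines_le.trans (mul_rpow_le_pow hn1 (by linarith) (by linarith))
    exact_mod_cast this
  have hwD : 2 ^ w ≤ n ^ D := by
    have : (2 : ℝ) ^ w ≤ (n : ℝ) ^ D := by
      rw [← Real.log_le_log_iff (by positivity) (by positivity), Real.log_pow, Real.log_pow]
      have h1 := Real.log_two_lt_d9
      have h2 : (w : ℝ) * Real.log 2 ≤ w := mul_le_of_le_one_right (Nat.cast_nonneg w) (by linarith)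
      have h3 : A * Real.log n ≤ D * Real.log n := by
        gcongr
        linarith
      exact (h2.trans hscale.word_le).trans h3
    exact_mod_cast this
  have hZ : Fintype.card (Item N S w) ≤ n ^ (5 * D) := by
    rw [card_item]
    calc N * (N * (S * (S * 2 ^ w)))
        ≤ n ^ D * (n ^ D * (n ^ D * (n ^ D * n ^ D))) := by gcongr
      _ = n ^ (5 * D) := by ring
  -- the cover-free families
  obtain ⟨P, hP, hTP, hPT⟩ := Nat.exists_prime_lt_and_le_two_mul ((S + 1) * (S + 1) * k)
    (by positivity)
  have : Fact P.Prime := ⟨hP⟩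
  have hSP : S ≤ P := by nlinarith [Nat.mul_le_mul_left ((S + 1) * (S + 1)) hk1]
  have hPk : n ^ (5 * D) ≤ P ^ k := by
    have h1 : (n : ℝ) ^ (5 * D) ≤ (P : ℝ) ^ k := by
      calc (n : ℝ) ^ (5 * D) = (n : ℝ) ^ ((5 * D : ℕ) : ℝ) := (Real.rpow_natCast _ _).symm
        _ ≤ (n : ℝ) ^ (δ * k) := by
          refine Real.rpow_le_rpow_of_exponent_le hn1 ?_
          push_cast
          rw [div_le_iff₀ hδ] at hk
          linarith
        _ = ((n : ℝ) ^ δ) ^ k := Real.rpow_mul_natCast hn0.le _ _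
        _ ≤ (P : ℝ) ^ k := by
          gcongr
          exact hSδ.trans (by exact_mod_cast hSP)
    exact_mod_cast h1
  obtain ⟨U, hU⟩ := exists_coverFree (Fin N) (P := P) (k := k) (r := S + 1)
    (by
      rw [Fintype.card_fin]
      exact (hND.trans (Nat.pow_le_pow_right (by omega) (by omega))).trans hPk)
    (lt_of_le_of_lt (Nat.mul_le_mul_right k (Nat.le_mul_of_pos_left _ (by omega))) hTP)
  obtain ⟨U', hU'⟩ := exists_coverFree (Item N S w) (P := P) (k := k) (r := (S + 1) * S)
    (hZ.trans hPk)
    (lt_of_le_of_lt (Nat.mul_le_mul_right k (Nat.mul_le_mul_left _ (by omega))) hTP)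
  -- the transformer
  obtain ⟨hp4, hpw, hp3, hp32⟩ := precision_bounds hn2 hND hwD hD1 hZ
  have hm : 0 < Fintype.card ((ZMod P × ZMod P) × Fin 3) := Fintype.card_pos
  have hqN : q ≤ N := hN ▸ le_max_right n q
  refine ⟨Fintype.card ((ZMod P × ZMod P) × Fin 3), 2, (15 * D + 7) * Nat.clog 2 n,
    transformerScaling_of_le hA (by linarith) (by omega) hSupp hPT,
    simulator π S _ hqN (Fintype.equivFin _).toEmbedding ⟨0, hm⟩ U U',
    usesSeedsLocally_simulator π hqN _ _ U U',
    fun ρ => simulator_simulates π rfl (hN ▸ le_max_left n q) hs hsS hp4 hpw hp3 hp32 hU hU' ρ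
      (hπ ρ)⟩

end

/-! ### The two regimes of context length -/

theorem mainTheorem1 :
    -- deterministic protocols with `γ < δ < 1`: context length `n`
    (∀ γ δ A : ℝ, 0 < γ → γ < δ → δ < 1 → 0 < A →
      ∃ (C : ℝ) (n₀ : ℕ), 0 < C ∧
        ∀ n nout q s w R : ℕ, n₀ ≤ n → nout ≤ n → MPCScaling γ δ A n q s w →
          ∀ π : MPCProtocol n nout q s w R, π.Valid →
            ∃ m H p : ℕ, TransformerScaling δ C n m H p ∧
              ∃ T : Transformer n m (R + 1) H, T.Simulates p π.output) ∧
    -- randomized protocols with arbitrary `γ, δ > 0`: context length `max n q`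
    (∀ γ δ A : ℝ, 0 < γ → 0 < δ → 0 < A →
      ∃ (C : ℝ) (n₀ : ℕ), 0 < C ∧
        ∀ n nout q s w R : ℕ, n₀ ≤ n → nout ≤ n → MPCScaling γ δ A n q s w →
          ∀ (Ω : Type*) (π : RandomizedMPCProtocol n nout q s w R Ω),
            (∀ ρ, (π.fixSeeds ρ).Valid) →
            ∃ m H p : ℕ, TransformerScaling δ C n m H p ∧
              ∃ T : (Fin R → Fin q → Ω) → Transformer (max n q) m (R + 1) H,
                UsesSeedsLocally T ∧
                ∀ ρ, (T ρ).Simulates p (π.fixSeeds ρ).output) := by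
  refine ⟨fun γ δ A hγ hγδ hδ1 hA => ?_, fun γ δ A hγ hδ hA => ?_⟩
  · obtain ⟨C, n₀, hC, h⟩ := exists_simulation γ δ A hγ (hγ.trans hγδ) hA
    -- Beyond this threshold `A ≤ n ^ (δ - γ)`, hence `q ≤ A * n ^ (1 + γ - δ) ≤ n` and the context
    -- length `max n q` is `n`.
    obtain ⟨n₁, hn₁⟩ := exists_nat_ge (A ^ (δ - γ)⁻¹)
    refine ⟨C, max n₀ (max n₁ 1), hC, fun n nout q s w R hn hnout hscale π hπ => ?_⟩
    have hn0 : (0 : ℝ) < n := by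
      exact_mod_cast ((le_max_right _ _).trans (le_max_right _ _)).trans hn
    have hqn : q ≤ n := by
      have hγδ' : 0 < δ - γ := sub_pos.2 hγδ
      have hAn : A ≤ (n : ℝ) ^ (δ - γ) := by
        have h1 : A ^ (δ - γ)⁻¹ ≤ n :=
          hn₁.trans (by exact_mod_cast ((le_max_left _ _).trans (le_max_right _ _)).trans hn)
        calc A = (A ^ (δ - γ)⁻¹) ^ (δ - γ) := (Real.rpow_inv_rpow hA.le hγδ'.ne').symm
          _ ≤ (n : ℝ) ^ (δ - γ) := by gcongr
      have h2 : (q : ℝ) ≤ n := by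
        calc (q : ℝ) ≤ A * (n : ℝ) ^ (1 + γ - δ) := hscale.machines_le
          _ ≤ (n : ℝ) ^ (δ - γ) * (n : ℝ) ^ (1 + γ - δ) := by gcongr
          _ = n := by
            rw [← Real.rpow_add hn0]
            ring_nf
            exact Real.rpow_one _
      exact_mod_cast h2
    -- A deterministic protocol is a randomized one with a single seed.
    let π' : RandomizedMPCProtocol n nout q s w R Unit :=
      ⟨fun r i _ => π.compute r i, π.decode, π.input_fits, π.output_fits⟩
    obtain ⟨m, H, p, hT, T, -, hsim⟩ := h n nout q s w R n ((le_max_left _ _).trans hn)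
      (max_eq_left hqn).symm hscale Unit π' fun _ => hπ
    exact ⟨m, H, p, hT, T fun _ _ => (), hsim _⟩
  · obtain ⟨C, n₀, hC, h⟩ := exists_simulation γ δ A hγ hδ hA
    exact ⟨C, n₀, hC, fun n nout q s w R hn _ hscale Ω π hπ =>
      h n nout q s w R (max n q) hn rfl hscale Ω π hπ⟩
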